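/- **Setting.** Let $N_t>2$, $P,\sigma,R_{\mathrm{th}},c,\alpha>0$ and $\varepsilon=2^{R_{\mathrm{th}}}-1$. A base station with $N_t$ antennas, total power $P$ and noise power $\sigma^2$ serves two single-antenna users by NOMA; user 1 is the (strong) user that performs successive interference cancellation. The channels $h_1,h_2\sim\mathcal{CN}(0,I_{N_t})$ and the $2^{B'}$ codewords, each uniform on the unit sphere of $\mathbb C^{N_t}$ (random vector quantization), are all independent. User $k$ reports the index of a codeword $w_k$ that maximizes $|h_k^Hc|^2$ over the codewords $c$, and the quantized gain $\hat H_{kk}=q(H_{kk})$, where $H_{ij}=|h_i^Hw_j|^2$, $q(x)=\lfloor x/\delta\rfloor\delta$ for $x<(2^B-1)\delta$ and $q(x)=(2^B-1)\delta$ otherwise, and the step satisfies $0<\delta\le c\,2^{-\alpha B}$ (for instance $\delta\propto 2^{-B}$). For gains $G=(G_{11},G_{22},G_{12},G_{21})$ put $$R(G;\beta)=\log_2\Bigl(1+\tfrac{\beta PG_{11}}{\sigma^2}\Bigr)+\log_2\Bigl(1+\tfrac{(1-\beta)PG_{22}}{\beta PG_{21}+\sigma^2}\Bigr),$$ and let $\mathcal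 B(G)$ be the set of all $\beta$ with $$\max\Bigl\{0,\tfrac{\varepsilon\sigma^2}{PG_{11}}\Bigr\}\le\beta\le\min\Bigl\{\tfrac{PG_{22}-\varepsilon\sigma^2}{PG_{22}+\varepsilon PG_{21}},\tfrac{PG_{12}-\varepsilon\sigma^2}{PG_{12}+\varepsilon PG_{11}},1\Bigr\}$$ (empty if $G_{11}=0$ or $G_{22}=0$). The full-CSI gains $H^*$ are $H^*_{ii}=\|h_i\|^2$ and $H^*_{ij}=|h_i^Hh_j|^2/\|h_j\|^2$ for $i\ne j$; the estimated gains $\hat H$ are $\hat H_{ii}$ and $\hat H_{ij}=\hat H_{ii}|w_i^Hw_j|^2$. Let $F$ be the event that NOMA is feasible both with full CSI and with limited feedback, i.e. $\mathcal B(H^*)\neq\emptyset$ and $\mathcal B(\hat H)\ne\emptyset$. On $F$ let $\beta^*$ maximize $R(H^*;\cdot)$ over $\mathcal B(H^*)$, let $\beta_q$ maximize $R(\hat H;\cdot)$ over $\mathcal B(\hat H)$, and let $\Delta R=R(H^*;\beta^*)-R(H;\beta_q)$ be the rate loss. Let $U$ be the event that $\delta<H_{kk}<(2^B-1)\delta$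 for $k=1,2$, and let $\Delta_{\mathrm{sat},k}=\max\{0,H_{kk}-(2^B-1)\delta\}$. **Theorem.** The expected rate loss converges to zero at least exponentially as $B$ and $B'$ increase: there are $b>0$, depending only on $N_t$, and $C>0$, depending only on $N_t,P,\sigma,R_{\mathrm{th}},c,\alpha$, such that for all $B,B',\delta$ as above $\Delta R$ is integrable on $F$ and $$\mathbb E\bigl[|\Delta R|\,\mathbf 1_{F\cap U}\bigr]\le C\bigl(2^{-\alpha B}+2^{-bB'}\bigr).$$ On all of $F$, saturation of the quantizer included, $$\mathbb E\bigl[|\Delta R|\,\mathbf 1_{F}\bigr]\le C\Bigl(2^{-\alpha B}+2^{-bB'}+\sum_{k=1}^2\sqrt{\mathbb E[\Delta_{\mathrm{sat},k}^2]}\Bigr).$$ These bounds hold for every measurable choice among ties in the selection of $w_k$, $\beta^*$ and $\beta_q$. -/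

import Mathlib

open MeasureTheory ProbabilityTheory

namespace MisoNoma

noncomputable section

/-- Complex vectors of length `N`, with the Euclidean norm and `inner ℂ h w = hᴴ w`. -/
abbrev Vec (N : ℕ) : Type := EuclideanSpace ℂ (Fin N)

/-- The law `CN(0, 1)`: independent real and imaginary parts, each `N(0, 1/2)`. -/
def cnScalar : Measure ℂ :=
  ((gaussianReal 0 (1 / 2)).prod (gaussianReal 0 (1 / 2))).map
    (fun p : ℝ × ℝ => (⟨p.1, p.2⟩ : ℂ))

/-- The law `CN(0, I_N)` of a Rayleigh channel vector: `N` independent `CN(0, 1)` entries. -/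
def cnVec (N : ℕ) : Measure (Vec N) :=
  (Measure.pi fun _ : Fin N => cnScalar).map (WithLp.toLp 2)

/-- The direction `h / ‖h‖` of a vector (`0` for `h = 0`). -/
def dir {N : ℕ} (h : Vec N) : Vec N := ((‖h‖⁻¹ : ℝ) : ℂ) • h

/-- The isotropic (uniform) law on the unit sphere of `ℂ^N`, realized as the law of the direction
of a `CN(0, I_N)` vector. The codewords of random vector quantization have this law. -/
def isotropicUnit (N : ℕ) : Measure (Vec N) := (cnVec N).map dir

/-- The gain `|hᴴ w|²` of the beam `w` over the channel `h`. -/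
def gain {N : ℕ} (h w : Vec N) : ℝ := ‖inner ℂ h w‖ ^ 2

/-- The uniform `B`-bit amplitude quantizer with step `δ`, which rounds down and saturates at
`(2 ^ B - 1) δ`. -/
def quantize (B : ℕ) (δ x : ℝ) : ℝ :=
  if x < (2 ^ B - 1) * δ then (⌊x / δ⌋ : ℝ) * δ else (2 ^ B - 1) * δ

/-- The amount `Δ_sat` by which a gain exceeds the largest quantizer level. -/
def saturation (B : ℕ) (δ x : ℝ) : ℝ := max 0 (x - (2 ^ B - 1) * δ)

/-- The four gains of the two-user link: `Hij` belongs to user `i` and the beam of user `j`. -/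
structure Gains where
  H11 : ℝ
  H22 : ℝ
  H12 : ℝ
  H21 : ℝ

/-- The gains of the channels `h₁, h₂` under the beams `w₁, w₂`. -/
def trueGains {N : ℕ} (h₁ h₂ w₁ w₂ : Vec N) : Gains where
  H11 := gain h₁ w₁
  H22 := gain h₂ w₂
  H12 := gain h₁ w₂
  H21 := gain h₂ w₁

/-- The gains with full CSI, where the beams are aligned with the channels. -/
def fullGains {N : ℕ} (h₁ h₂ : Vec N) : Gains where
  H11 := ‖h₁‖ ^ 2
  H22 := ‖h₂‖ ^ 2
  H12 := gain h₁ (dir h₂)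
  H21 := gain h₂ (dir h₁)

/-- The gains as estimated by the base station from the feedback: quantized effective gains, and
interference gains `Ĥij = Ĥii |wᵢᴴ wⱼ|²`. -/
def estGains {N : ℕ} (B : ℕ) (δ : ℝ) (h₁ h₂ w₁ w₂ : Vec N) : Gains where
  H11 := quantize B δ (gain h₁ w₁)
  H22 := quantize B δ (gain h₂ w₂)
  H12 := quantize B δ (gain h₁ w₁) * gain w₁ w₂
  H21 := quantize B δ (gain h₂ w₂) * gain w₂ w₁

/-- The sum rate in bits when user 1 (which performs SIC) gets the power `β P` and user 2 gets
`(1 - β) P`, for noise power `σ²`. -/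
def sumRate (P σ : ℝ) (G : Gains) (β : ℝ) : ℝ :=
  Real.logb 2 (1 + β * P * G.H11 / σ ^ 2) +
    Real.logb 2 (1 + (1 - β) * P * G.H22 / (β * P * G.H21 + σ ^ 2))

/-- Least allocation for which user 1 can decode its own message (`ε` is the SINR threshold). -/
def beta1Min (P σ ε : ℝ) (G : Gains) : ℝ := ε * σ ^ 2 / (P * G.H11)

/-- Largest allocation for which user 2 can decode its own message. -/
def beta2Max (P σ ε : ℝ) (G : Gains) : ℝ :=
  (P * G.H22 - ε * σ ^ 2) / (P * G.H22 + ε * P * G.H21)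

/-- Largest allocation for which user 1 can decode the message of user 2. -/
def betaSICMax (P σ ε : ℝ) (G : Gains) : ℝ :=
  (P * G.H12 - ε * σ ^ 2) / (P * G.H12 + ε * P * G.H11)

/-- The set of admissible power allocations. If `H11 = 0` or `H22 = 0` the bounds degenerate to
`∞` and `-∞` respectively, and there is no admissible allocation; this is what the two positivity
conditions record. -/
def allocSet (P σ ε : ℝ) (G : Gains) : Set ℝ :=
  {β | 0 < G.H11 ∧ 0 < G.H22 ∧ max 0 (beta1Min P σ ε G) ≤ β ∧
    β ≤ min (min (beta2Max P σ ε G) (betaSICMax P σ ε G)) 1}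

/-- `β` maximizes the sum rate over the admissible allocations. -/
def IsOptimalAlloc (P σ ε : ℝ) (G : Gains) (β : ℝ) : Prop :=
  β ∈ allocSet P σ ε G ∧ IsMaxOn (sumRate P σ G) (allocSet P σ ε G) β

/-- NOMA is feasible for the gains `G`: an admissible allocation exists. -/
def Feasible (P σ ε : ℝ) (G : Gains) : Prop := (allocSet P σ ε G).Nonempty

/-- The limited-feedback two-user MISO-NOMA system over Rayleigh channels with an RVQ codebook of
`2 ^ B'` codewords. User 1 of the text is `0 : Fin 2`, user 2 is `1 : Fin 2`. -/
structure IsSystem {Ω : Type*} [MeasurableSpace Ω] (μ : Measure Ω) (N B B' : ℕ) (P σ ε δ : ℝ)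
    (h : Fin 2 → Ω → Vec N) (code : Fin (2 ^ B') → Ω → Vec N)
    (j : Fin 2 → Ω → Fin (2 ^ B')) (βstar βq : Ω → ℝ) : Prop where
  /-- Rayleigh channels. -/
  law_channel : ∀ k, HasLaw (h k) (cnVec N) μ
  /-- Isotropic codewords. -/
  law_code : ∀ i, HasLaw (code i) (isotropicUnit N) μ
  /-- The two channels and all the codewords are independent. -/
  indep : iIndepFun (Sum.elim h code) μ
  /-- Each user reports a codeword of largest gain (ties may be broken in any measurable way). -/
  meas_index : ∀ k, AEMeasurable (j k) μ
  index_max : ∀ k ω i, gain (h k ω) (code i ω) ≤ gain (h k ω) (code (j k ω) ω)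
  /-- `βstar` is an optimal allocation with full CSI whenever NOMA is feasible with full CSI. -/
  meas_star : AEMeasurable βstar μ
  star_opt : ∀ ω, Feasible P σ ε (fullGains (h 0 ω) (h 1 ω)) →
    IsOptimalAlloc P σ ε (fullGains (h 0 ω) (h 1 ω)) (βstar ω)
  /-- `βq` is optimal for the gains that the base station estimates, whenever NOMA is feasible
  for these. -/
  meas_q : AEMeasurable βq μ
  q_opt : ∀ ω, Feasible P σ ε
      (estGains B δ (h 0 ω) (h 1 ω) (code (j 0 ω) ω) (code (j 1 ω) ω)) →
    IsOptimalAlloc P σ ε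
      (estGains B δ (h 0 ω) (h 1 ω) (code (j 0 ω) ω) (code (j 1 ω) ω)) (βq ω)

/-- The rate loss: the full-CSI sum rate at `β*` minus the sum rate that the allocation `βq` and
the reported beams `w₁, w₂` achieve over the true channels. -/
def rateLoss {N : ℕ} (P σ : ℝ) (h₁ h₂ w₁ w₂ : Vec N) (βstar βq : ℝ) : ℝ :=
  sumRate P σ (fullGains h₁ h₂) βstar - sumRate P σ (trueGains h₁ h₂ w₁ w₂) βq

/-- The outcomes for which NOMA is feasible both with full CSI and with limited feedback. -/
def feasibleRegion {Ω : Type*} {N B' : ℕ} (B : ℕ) (P σ ε δ : ℝ)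
    (h : Fin 2 → Ω → Vec N) (code : Fin (2 ^ B') → Ω → Vec N)
    (j : Fin 2 → Ω → Fin (2 ^ B')) : Set Ω :=
  {ω | Feasible P σ ε (fullGains (h 0 ω) (h 1 ω)) ∧
    Feasible P σ ε (estGains B δ (h 0 ω) (h 1 ω) (code (j 0 ω) ω) (code (j 1 ω) ω))}

/-- The outcomes for which the effective gains of both users lie inside the quantizer range. -/
def unsaturatedRegion {Ω : Type*} {N B' : ℕ} (B : ℕ) (δ : ℝ)
    (h : Fin 2 → Ω → Vec N) (code : Fin (2 ^ B') → Ω → Vec N)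
    (j : Fin 2 → Ω → Fin (2 ^ B')) : Set Ω :=
  {ω | ∀ k, δ < gain (h k ω) (code (j k ω) ω) ∧
    gain (h k ω) (code (j k ω) ω) < (2 ^ B - 1) * δ}

end

end MisoNoma

/-! The proof is a pathwise perturbation bound followed by averaging. If NOMA is feasible for gains
`G`, then `P * G.H11`, `P * G.H22` and `P * G.H12` are at least `ε * σ ^ 2`. On such gains the
endpoints of the admissible interval are Lipschitz, with constants depending only on `P, σ, ε`. So
two nonempty admissible sets of nearby gains are Hausdorff-close (`exists_mem_allocSet_near`). The
sum rate is Lipschitz in the gains, and in `β` with a constant proportional to the size of the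
gains. Hence `|ΔR| ≤ K * (1 + M) * D`, where `M = ‖h₁‖² + ‖h₂‖²` and `D` collects the step `δ`, the
saturation and `M` times the chordal errors of the beams (`abs_rateLoss_le`).

In expectation, Cauchy–Schwarz separates these errors from the powers of `1 + M`, whose moments are
finite because the channels are Gaussian. A codeword falls within `r` of a given line with
probability at least `κ * r ^ (2 * N)`. With `r = 2 ^ (-B' / (4 * N))`, all `2 ^ B'` independent
codewords miss with probability at most `r ^ 2 / κ`, so the root-mean-square chordal error is `O(r)`
(`exists_integral_dirError_sq_le`). This gives `b = 1 / (4 * N)`. The errors of the two users share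
a codebook and are dependent, but they enter the bound additively. -/

namespace MisoNoma

/-! ### Deterministic stability of the optimal power allocation. -/

/-- All four gains are nonnegative. -/
def Gains.Nonneg (G : Gains) : Prop := 0 ≤ G.H11 ∧ 0 ≤ G.H22 ∧ 0 ≤ G.H12 ∧ 0 ≤ G.H21

/-- All four gains are at most `M`. -/
def Gains.BoundedBy (G : Gains) (M : ℝ) : Prop :=
  G.H11 ≤ M ∧ G.H22 ≤ M ∧ G.H12 ≤ M ∧ G.H21 ≤ M

/-- The four gains of `G` and `G'` agree up to `D`. -/
def Gains.Close (G G' : Gains) (D : ℝ) : Prop :=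
  |G.H11 - G'.H11| ≤ D ∧ |G.H22 - G'.H22| ≤ D ∧ |G.H12 - G'.H12| ≤ D ∧ |G.H21 - G'.H21| ≤ D

theorem Gains.Close.symm {G G' : Gains} {D : ℝ} (h : G.Close G' D) : G'.Close G D := by
  obtain ⟨h1, h2, h3, h4⟩ := h
  refine ⟨?_, ?_, ?_, ?_⟩ <;> rw [abs_sub_comm] <;> assumption

theorem abs_logb_sub_le {m x y : ℝ} (hm : 0 < m) (hx : m ≤ x) (hy : m ≤ y) :
    |Real.logb 2 x - Real.logb 2 y| ≤ |x - y| / (m * Real.log 2) := by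
  have key : ∀ {x y : ℝ}, m ≤ x → m ≤ y → Real.log x - Real.log y ≤ |x - y| / m := by
    intro x y hx hy
    have hx0 := hm.trans_le hx
    have hy0 := hm.trans_le hy
    rw [← Real.log_div hx0.ne' hy0.ne']
    calc Real.log (x / y) ≤ x / y - 1 := Real.log_le_sub_one_of_pos (by positivity)
      _ = (x - y) / y := by field_simp
      _ ≤ |x - y| / y := by gcongr; exact le_abs_self _
      _ ≤ |x - y| / m := by gcongr
  have hl : 0 < Real.log 2 := Real.log_pos one_lt_two
  rw [Real.logb, Real.logb, ← sub_div, abs_div, abs_of_pos hl, ← div_div]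
  gcongr
  rw [abs_sub_le_iff]
  exact ⟨key hx hy, by rw [abs_sub_comm]; exact key hy hx⟩

/-- Every logarithm now has an argument at least `σ ^ 2` that is affine in the received powers, so
the Lipschitz bound for `logb` applies with `m = σ ^ 2`. -/
theorem sumRate_eq {P σ β : ℝ} {G : Gains} (hP : 0 < P) (hσ : 0 < σ) (hβ : 0 ≤ β) (hβ1 : β ≤ 1)
    (hG : G.Nonneg) :
    sumRate P σ G β = Real.logb 2 (σ ^ 2 + β * P * G.H11) - Real.logb 2 (σ ^ 2) +
      (Real.logb 2 (β * P * G.H21 + σ ^ 2 + (1 - β) * P * G.H22) -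
        Real.logb 2 (β * P * G.H21 + σ ^ 2)) := by
  obtain ⟨h1, h2, -, h4⟩ := hG
  have hb : 0 ≤ 1 - β := by linarith
  have e1 : 0 < σ ^ 2 + β * P * G.H11 := by positivity
  have e2 : 0 < β * P * G.H21 + σ ^ 2 := by positivity
  have e3 : 0 < β * P * G.H21 + σ ^ 2 + (1 - β) * P * G.H22 := by positivity
  have e4 : 0 < σ ^ 2 := by positivity
  rw [sumRate, ← Real.logb_div e1.ne' e4.ne', ← Real.logb_div e3.ne' e2.ne']
  congr 2 <;> field_simp

/-- The interference term is counted twice because it occurs in two of the logarithms. -/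
theorem abs_sumRate_sub_le {P σ β β' : ℝ} {G G' : Gains} (hP : 0 < P) (hσ : 0 < σ)
    (hβ : 0 ≤ β) (hβ1 : β ≤ 1) (hβ' : 0 ≤ β') (hβ1' : β' ≤ 1) (hG : G.Nonneg) (hG' : G'.Nonneg) :
    |sumRate P σ G β - sumRate P σ G' β'| ≤
      (|β * P * G.H11 - β' * P * G'.H11| + 2 * |β * P * G.H21 - β' * P * G'.H21| +
        |(1 - β) * P * G.H22 - (1 - β') * P * G'.H22|) / (σ ^ 2 * Real.log 2) := by
  rw [sumRate_eq hP hσ hβ hβ1 hG, sumRate_eq hP hσ hβ' hβ1' hG']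
  obtain ⟨h1, h2, -, h4⟩ := hG
  obtain ⟨h1', h2', -, h4'⟩ := hG'
  have hb : 0 ≤ 1 - β := by linarith
  have hb' : 0 ≤ 1 - β' := by linarith
  have e4 : 0 < σ ^ 2 := by positivity
  have hl : 0 < Real.log 2 := Real.log_pos one_lt_two
  have a1 : 0 ≤ β * P * G.H11 := by positivity
  have a2 : 0 ≤ β * P * G.H21 := by positivity
  have a3 : 0 ≤ (1 - β) * P * G.H22 := by positivity
  have a1' : 0 ≤ β' * P * G'.H11 := by positivity
  have a2' : 0 ≤ β' * P * G'.H21 := by positivity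
  have a3' : 0 ≤ (1 - β') * P * G'.H22 := by positivity
  generalize β * P * G.H11 = x at *
  generalize β * P * G.H21 = y at *
  generalize (1 - β) * P * G.H22 = z at *
  generalize β' * P * G'.H11 = x' at *
  generalize β' * P * G'.H21 = y' at *
  generalize (1 - β') * P * G'.H22 = z' at *
  have b1 := abs_logb_sub_le (x := σ ^ 2 + x) (y := σ ^ 2 + x') e4 (by linarith) (by linarith)
  have b2 := abs_logb_sub_le (x := y + σ ^ 2) (y := y' + σ ^ 2) e4 (by linarith) (by linarith)
  have b3 := abs_logb_sub_le (x := y + σ ^ 2 + z) (y := y' + σ ^ 2 + z') e4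
    (by linarith) (by linarith)
  have hk : 0 < σ ^ 2 * Real.log 2 := by positivity
  rw [le_div_iff₀ hk] at b1 b2 b3 ⊢
  have c1 : |σ ^ 2 + x - (σ ^ 2 + x')| = |x - x'| := by congr 1; ring
  have c2 : |y + σ ^ 2 - (y' + σ ^ 2)| = |y - y'| := by congr 1; ring
  have c3 : |y + σ ^ 2 + z - (y' + σ ^ 2 + z')| ≤ |y - y'| + |z - z'| := by
    rw [show y + σ ^ 2 + z - (y' + σ ^ 2 + z') = (y - y') + (z - z') by ring]
    exact abs_add_le _ _
  rw [c1] at b1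
  rw [c2] at b2
  generalize Real.logb 2 (σ ^ 2 + x) = l1 at *
  generalize Real.logb 2 (σ ^ 2 + x') = l1' at *
  generalize Real.logb 2 (y + σ ^ 2 + z) = l3 at *
  generalize Real.logb 2 (y' + σ ^ 2 + z') = l3' at *
  generalize Real.logb 2 (y + σ ^ 2) = l2 at *
  generalize Real.logb 2 (y' + σ ^ 2) = l2' at *
  have t : |l1 - Real.logb 2 (σ ^ 2) + (l3 - l2) - (l1' - Real.logb 2 (σ ^ 2) + (l3' - l2'))| ≤
      |l1 - l1'| + |l2 - l2'| + |l3 - l3'| := by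
    rw [abs_le]
    constructor <;>
      linarith [neg_abs_le (l1 - l1'), le_abs_self (l1 - l1'), neg_abs_le (l2 - l2'),
        le_abs_self (l2 - l2'), neg_abs_le (l3 - l3'), le_abs_self (l3 - l3')]
  have := mul_le_mul_of_nonneg_right t hk.le
  linarith

theorem abs_sumRate_sub_le_of_close {P σ β D : ℝ} {G G' : Gains} (hP : 0 < P) (hσ : 0 < σ)
    (hβ : 0 ≤ β) (hβ1 : β ≤ 1) (hG : G.Nonneg) (hG' : G'.Nonneg) (hD : G.Close G' D) :
    |sumRate P σ G β - sumRate P σ G' β| ≤ 4 * P * D / (σ ^ 2 * Real.log 2) := by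
  refine (abs_sumRate_sub_le hP hσ hβ hβ1 hβ hβ1 hG hG').trans ?_
  have hl : 0 < Real.log 2 := Real.log_pos one_lt_two
  have key : ∀ {t a b : ℝ}, 0 ≤ t → t ≤ 1 → |a - b| ≤ D → |t * P * a - t * P * b| ≤ P * D := by
    intro t a b ht ht1 hab
    rw [← mul_sub, abs_mul, abs_of_nonneg (by positivity)]
    calc t * P * |a - b| ≤ 1 * P * D := by gcongr
      _ = P * D := by ring
  obtain ⟨h1, h2, -, h4⟩ := hD
  gcongr
  have := key hβ hβ1 h1
  have := key hβ hβ1 h4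
  have := key (t := 1 - β) (by linarith) (by linarith) h2
  linarith

theorem abs_sumRate_sub_le_of_boundedBy {P σ β β' M : ℝ} {G : Gains} (hP : 0 < P) (hσ : 0 < σ)
    (hβ : 0 ≤ β) (hβ1 : β ≤ 1) (hβ' : 0 ≤ β') (hβ1' : β' ≤ 1) (hG : G.Nonneg)
    (hM : G.BoundedBy M) :
    |sumRate P σ G β - sumRate P σ G β'| ≤ 4 * P * M * |β - β'| / (σ ^ 2 * Real.log 2) := by
  refine (abs_sumRate_sub_le hP hσ hβ hβ1 hβ' hβ1' hG hG).trans ?_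
  have hl : 0 < Real.log 2 := Real.log_pos one_lt_two
  have key : ∀ {t t' a : ℝ}, 0 ≤ a → a ≤ M →
      |t * P * a - t' * P * a| ≤ P * M * |t - t'| := by
    intro t t' a ha haM
    rw [show t * P * a - t' * P * a = P * a * (t - t') by ring, abs_mul,
      abs_of_nonneg (by positivity)]
    gcongr
  obtain ⟨h1, h2, -, h4⟩ := hG
  obtain ⟨m1, m2, -, m4⟩ := hM
  gcongr
  have k1 := key (t := β) (t' := β') h1 m1
  have k2 := key (t := β) (t' := β') h4 m4
  have k3 := key (t := 1 - β) (t' := 1 - β') h2 m2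
  rw [show 1 - β - (1 - β') = -(β - β') by ring, abs_neg] at k3
  linarith

theorem abs_threshold_div_sub_le {k x x' d : ℝ} (hk : 0 < k) (hx : k ≤ x) (hx' : k ≤ x')
    (hd : |x - x'| ≤ d) : |k / x - k / x'| ≤ d / k := by
  have h0 := hk.trans_le hx
  have h0' := hk.trans_le hx'
  rw [div_sub_div _ _ h0.ne' h0'.ne', abs_div, abs_of_pos (mul_pos h0 h0'),
    show k * x' - x * k = k * -(x - x') by ring, abs_mul, abs_neg, abs_of_pos hk,
    div_le_div_iff₀ (by positivity) hk]
  have hd0 := (abs_nonneg _).trans hd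
  calc k * |x - x'| * k = |x - x'| * (k * k) := by ring
    _ ≤ d * (x * x') := by gcongr

theorem abs_sinr_bound_sub_le {k ε x x' y y' d : ℝ} (hk : 0 < k) (hε : 0 < ε)
    (hx : k ≤ x) (hx' : k ≤ x') (hy : 0 ≤ y) (hy' : 0 ≤ y') (hd : |x - x'| ≤ d)
    (hd' : |y - y'| ≤ d) :
    |(x - k) / (x + ε * y) - (x' - k) / (x' + ε * y')| ≤ (2 + ε) * d / k := by
  have h0 : k ≤ x + ε * y := by nlinarith
  have h0' : k ≤ x' + ε * y' := by nlinarith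
  have hd0 := (abs_nonneg _).trans hd
  set u := x + ε * y
  set u' := x' + ε * y'
  have hu := hk.trans_le h0
  have hu' := hk.trans_le h0'
  have hr : |(x' - k) / u'| ≤ 1 := by
    rw [abs_of_nonneg (div_nonneg (by linarith) hu'.le), div_le_one hu']
    nlinarith [show u' = x' + ε * y' from rfl, mul_nonneg hε.le hy']
  have huu : |u' - u| ≤ (1 + ε) * d := by
    rw [show u' - u = -(x - x') + -(ε * (y - y')) by simp only [u, u']; ring]
    refine (abs_add_le _ _).trans ?_
    rw [abs_neg, abs_neg, abs_mul, abs_of_pos hε]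
    nlinarith
  -- In this form only `1 / u ≤ 1 / k` is needed, since the second quotient lies in `[0, 1]`. The
  -- constant is `2 + ε = 1 + (1 + ε)`.
  rw [show (x - k) / u - (x' - k) / u' = ((x - x') + (x' - k) / u' * (u' - u)) / u by
    field_simp; ring, abs_div, abs_of_pos hu]
  have hnum : |(x - x') + (x' - k) / u' * (u' - u)| ≤ (2 + ε) * d := by
    refine (abs_add_le _ _).trans ?_
    rw [abs_mul]
    have := mul_le_mul hr huu (abs_nonneg _) zero_le_one
    linarith
  gcongr

/-- Feasibility keeps the relevant gains away from zero: the lower endpoint is at most 1 and both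
upper bounds are nonnegative. This makes the endpoints Lipschitz. -/
theorem gains_ge_of_mem_allocSet {P σ ε β : ℝ} {G : Gains} (hP : 0 < P) (hε : 0 < ε)
    (hG : G.Nonneg) (h : β ∈ allocSet P σ ε G) :
    ε * σ ^ 2 ≤ P * G.H11 ∧ ε * σ ^ 2 ≤ P * G.H22 ∧ ε * σ ^ 2 ≤ P * G.H12 ∧ 0 ≤ β ∧ β ≤ 1 := by
  obtain ⟨h1, h2, hl, hu⟩ := h
  obtain ⟨-, -, h3, h4⟩ := hG
  rw [le_min_iff, le_min_iff] at hu
  rw [max_le_iff] at hl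
  obtain ⟨hl0, hl⟩ := hl
  obtain ⟨⟨hu1, hu2⟩, hu3⟩ := hu
  refine ⟨?_, ?_, ?_, hl0, hu3⟩
  · have := hl.trans hu3
    rwa [beta1Min, div_le_one (by positivity)] at this
  · have := hl0.trans hu1
    rw [beta2Max, le_div_iff₀ (by positivity)] at this
    linarith
  · have := hl0.trans hu2
    rw [betaSICMax, le_div_iff₀ (by positivity)] at this
    linarith

/-- Admissible sets of nearby gains are close in the Hausdorff distance, once nonempty. -/
theorem exists_mem_allocSet_near {P σ ε β D : ℝ} {G G' : Gains} (hP : 0 < P) (hσ : 0 < σ)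
    (hε : 0 < ε) (hG : G.Nonneg) (hG' : G'.Nonneg) (hD : G.Close G' D)
    (hf : Feasible P σ ε G) (hβ : β ∈ allocSet P σ ε G') :
    ∃ β' ∈ allocSet P σ ε G, |β - β'| ≤ (2 + ε) * (P * D) / (ε * σ ^ 2) := by
  obtain ⟨β₀, h₀⟩ := hf
  obtain ⟨a1, a2, a3, -, -⟩ := gains_ge_of_mem_allocSet hP hε hG h₀
  obtain ⟨b1, b2, b3, -, -⟩ := gains_ge_of_mem_allocSet hP hε hG' hβ
  obtain ⟨p1, p2, hl, hu⟩ := h₀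
  obtain ⟨-, -, hl', hu'⟩ := hβ
  have hk : 0 < ε * σ ^ 2 := by positivity
  obtain ⟨-, -, -, n4⟩ := hG
  obtain ⟨p1', -, -, n4'⟩ := hG'
  have sc : ∀ {x y : ℝ}, |x - y| ≤ D → |P * x - P * y| ≤ P * D := by
    intro x y h
    rw [← mul_sub, abs_mul, abs_of_pos hP]
    gcongr
  obtain ⟨d1, d2, d3, d4⟩ := hD
  have hD0 := (abs_nonneg _).trans d1
  set T := (2 + ε) * (P * D) / (ε * σ ^ 2) with hT
  have t1 : |beta1Min P σ ε G - beta1Min P σ ε G'| ≤ T := by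
    refine (abs_threshold_div_sub_le hk a1 b1 (sc d1)).trans ?_
    exact div_le_div_of_nonneg_right (by nlinarith [mul_nonneg hP.le hD0]) hk.le
  have t2 : |beta2Max P σ ε G - beta2Max P σ ε G'| ≤ T := by
    have := abs_sinr_bound_sub_le hk hε a2 b2 (y := P * G.H21) (y' := P * G'.H21)
      (by positivity) (by positivity) (sc d2) (sc d4)
    simpa only [beta2Max, mul_assoc] using this
  have t3 : |betaSICMax P σ ε G - betaSICMax P σ ε G'| ≤ T := by
    have := abs_sinr_bound_sub_le hk hε a3 b3 (y := P * G.H11) (y' := P * G'.H11)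
      (by positivity) (by positivity) (sc d3) (sc d1)
    simpa only [betaSICMax, mul_assoc] using this
  have hT0 := (abs_nonneg _).trans t1
  have tl : max 0 (beta1Min P σ ε G) ≤ max 0 (beta1Min P σ ε G') + T := by
    rw [abs_le] at t1
    refine max_le ?_ ?_
    · linarith [le_max_left 0 (beta1Min P σ ε G')]
    · linarith [le_max_right 0 (beta1Min P σ ε G')]
  have tu : min (min (beta2Max P σ ε G') (betaSICMax P σ ε G')) 1 - T ≤
      min (min (beta2Max P σ ε G) (betaSICMax P σ ε G)) 1 := by
    rw [abs_le] at t2 t3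
    have m1 := min_le_left (min (beta2Max P σ ε G') (betaSICMax P σ ε G')) 1
    have m2 := min_le_right (min (beta2Max P σ ε G') (betaSICMax P σ ε G')) 1
    have m3 := min_le_left (beta2Max P σ ε G') (betaSICMax P σ ε G')
    have m4 := min_le_right (beta2Max P σ ε G') (betaSICMax P σ ε G')
    refine le_min (le_min ?_ ?_) ?_ <;> linarith
  have hlu := hl.trans hu
  generalize max 0 (beta1Min P σ ε G') = l' at *
  generalize min (min (beta2Max P σ ε G') (betaSICMax P σ ε G')) 1 = u' at *
  generalize hl2 : max 0 (beta1Min P σ ε G) = l at *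
  generalize hu2 : min (min (beta2Max P σ ε G) (betaSICMax P σ ε G)) 1 = u at *
  -- The witness is the projection of `β` onto `[l, u]`; both endpoints move by at most `T`.
  refine ⟨max l (min u β), ⟨p1, p2, ?_, ?_⟩, ?_⟩
  · rw [hl2]; exact le_max_left _ _
  · rw [hu2]; exact max_le hlu (min_le_left _ _)
  · rw [abs_le]
    have q1 : max l (min u β) ≤ β + T := max_le (by linarith) (by linarith [min_le_right u β])
    have q2 : β - T ≤ max l (min u β) :=
      (le_min (by linarith) (by linarith)).trans (le_max_right _ _)
    constructor <;> linarith

/-- The loss from allocating power optimally for the estimate `G'` of `G` while the achieved rate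
is governed by the gains `H`. -/
theorem abs_optimal_sumRate_sub_le {P σ ε β β' D M : ℝ} {G G' H : Gains} (hP : 0 < P) (hσ : 0 < σ)
    (hε : 0 < ε) (hG : G.Nonneg) (hG' : G'.Nonneg) (hH : H.Nonneg) (hM : G.BoundedBy M)
    (hD : G.Close G' D) (hD' : G.Close H D)
    (hβ : IsOptimalAlloc P σ ε G β) (hβ' : IsOptimalAlloc P σ ε G' β') :
    |sumRate P σ G β - sumRate P σ H β'| ≤
      4 * P / (σ ^ 2 * Real.log 2) * (3 + (2 + ε) * P / (ε * σ ^ 2)) * ((1 + M) * D) := by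
  have hl : 0 < Real.log 2 := Real.log_pos one_lt_two
  obtain ⟨mβ, oβ⟩ := hβ
  obtain ⟨mβ', oβ'⟩ := hβ'
  have unit : ∀ {G : Gains} {b : ℝ}, G.Nonneg → b ∈ allocSet P σ ε G → 0 ≤ b ∧ b ≤ 1 :=
    fun hG hb => (gains_ge_of_mem_allocSet hP hε hG hb).2.2.2
  have iβ := unit hG mβ
  have iβ' := unit hG' mβ'
  have hM0 : 0 ≤ M := hG.1.trans hM.1
  have hD0 := (abs_nonneg _).trans hD.1
  obtain ⟨b1, mb1, nb1⟩ := exists_mem_allocSet_near hP hσ hε hG hG' hD ⟨β, mβ⟩ mβ'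
  obtain ⟨b2, mb2, nb2⟩ := exists_mem_allocSet_near hP hσ hε hG' hG hD.symm ⟨β', mβ'⟩ mβ
  have ib1 := unit hG mb1
  have ib2 := unit hG' mb2
  set T := (2 + ε) * (P * D) / (ε * σ ^ 2) with hT
  set K := 4 * P / (σ ^ 2 * Real.log 2) with hK
  have hK0 : 0 < K := by positivity
  have v1 : |sumRate P σ G β' - sumRate P σ G b1| ≤ K * M * T := by
    refine (abs_sumRate_sub_le_of_boundedBy hP hσ iβ'.1 iβ'.2 ib1.1 ib1.2 hG hM).trans ?_
    calc _ = K * M * |β' - b1| := by rw [hK]; ring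
      _ ≤ _ := by gcongr
  have v2 : |sumRate P σ G β - sumRate P σ G b2| ≤ K * M * T := by
    refine (abs_sumRate_sub_le_of_boundedBy hP hσ iβ.1 iβ.2 ib2.1 ib2.2 hG hM).trans ?_
    calc _ = K * M * |β - b2| := by rw [hK]; ring
      _ ≤ _ := by gcongr
  have eK : 4 * P * D / (σ ^ 2 * Real.log 2) = K * D := by rw [hK]; ring
  have w1 := abs_sumRate_sub_le_of_close hP hσ iβ'.1 iβ'.2 hG hG' hD
  have w2 := abs_sumRate_sub_le_of_close hP hσ ib2.1 ib2.2 hG hG' hD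
  have w3 := abs_sumRate_sub_le_of_close hP hσ iβ'.1 iβ'.2 hG hH hD'
  rw [eK] at w1 w2 w3
  have o1 : sumRate P σ G b1 ≤ sumRate P σ G β := oβ mb1
  have o2 : sumRate P σ G' b2 ≤ sumRate P σ G' β' := oβ' mb2
  -- Upper bound: pass from `β` to `b2`, from `G` to `G'`, use optimality of `β'`, then go back to
  -- `G` and on to `H`. Lower bound: pass from `H` to `G`, from `β'` to `b1`, and use optimality of
  -- `β`.
  have main : |sumRate P σ G β - sumRate P σ H β'| ≤ K * M * T + 3 * (K * D) := by
    rw [abs_le] at *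
    constructor <;> linarith [v1.1, v1.2, v2.1, v2.2, w1.1, w1.2, w2.1, w2.2, w3.1, w3.2]
  refine main.trans ?_
  have hs : T = (2 + ε) * P / (ε * σ ^ 2) * D := by rw [hT]; ring
  rw [hs]
  have hs0 : 0 ≤ (2 + ε) * P / (ε * σ ^ 2) := by positivity
  generalize (2 + ε) * P / (ε * σ ^ 2) = s at *
  have := mul_nonneg (mul_nonneg hK0.le hM0) hD0
  have := mul_nonneg (mul_nonneg hK0.le hs0) hD0
  nlinarith

/-! ### The amplitude quantizer. -/

theorem quantize_nonneg {B : ℕ} {δ x : ℝ} (hδ : 0 < δ) (hx : 0 ≤ x) : 0 ≤ quantize B δ x := by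
  have h2 : (1 : ℝ) ≤ 2 ^ B := one_le_pow₀ one_le_two
  rw [quantize]
  split_ifs
  · have : 0 ≤ ⌊x / δ⌋ := Int.floor_nonneg.2 (by positivity)
    positivity
  · exact mul_nonneg (by linarith) hδ.le

theorem saturation_nonneg {B : ℕ} {δ x : ℝ} : 0 ≤ saturation B δ x := le_max_left _ _

theorem saturation_le {B : ℕ} {δ x : ℝ} (hδ : 0 < δ) (hx : 0 ≤ x) : saturation B δ x ≤ x := by
  have h2 : (1 : ℝ) ≤ 2 ^ B := one_le_pow₀ one_le_two
  have := mul_nonneg (sub_nonneg.2 h2) hδ.le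
  exact max_le hx (by linarith)

theorem abs_quantize_sub_le {B : ℕ} {δ x : ℝ} (hδ : 0 < δ) :
    |quantize B δ x - x| ≤ δ + saturation B δ x := by
  have hs := saturation_nonneg (B := B) (δ := δ) (x := x)
  rw [quantize]
  split_ifs with h
  · have h1 : (⌊x / δ⌋ : ℝ) * δ ≤ x := by
      rw [← le_div_iff₀ hδ]; exact Int.floor_le _
    have h2 : x < ((⌊x / δ⌋ : ℝ) + 1) * δ := by
      rw [← div_lt_iff₀ hδ]; exact Int.lt_floor_add_one _
    rw [abs_le]
    constructor <;> linarith
  · have : x - (2 ^ B - 1) * δ ≤ saturation B δ x := le_max_right _ _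
    push Not at h
    rw [abs_le]
    constructor <;> linarith

/-! ### Chordal geometry of the beams and the pathwise bound on the rate loss. -/

theorem gain_nonneg {N : ℕ} (h w : Vec N) : 0 ≤ gain h w := by unfold gain; positivity

theorem gain_comm {N : ℕ} (h w : Vec N) : gain h w = gain w h := by
  rw [gain, gain, norm_inner_symm]

theorem gain_le {N : ℕ} (h w : Vec N) : gain h w ≤ ‖h‖ ^ 2 * ‖w‖ ^ 2 := by
  rw [gain, ← mul_pow]
  gcongr
  exact norm_inner_le_norm _ _

theorem gain_le_of_norm_le {N : ℕ} {h w : Vec N} (hw : ‖w‖ ≤ 1) : gain h w ≤ ‖h‖ ^ 2 := by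
  refine (gain_le h w).trans (mul_le_of_le_one_right (by positivity) ?_)
  exact pow_le_one₀ (norm_nonneg _) hw

theorem norm_dir_le {N : ℕ} (h : Vec N) : ‖dir h‖ ≤ 1 := by
  rw [dir, norm_smul, Complex.norm_real, norm_inv, norm_norm]
  exact inv_mul_le_one

theorem norm_dir {N : ℕ} {h : Vec N} (hh : h ≠ 0) : ‖dir h‖ = 1 := by
  rw [dir, norm_smul, Complex.norm_real, norm_inv, norm_norm]
  exact inv_mul_cancel₀ (norm_ne_zero_iff.2 hh)

theorem gain_eq_norm_sq_mul_gain_dir {N : ℕ} (h w : Vec N) :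
    gain h w = ‖h‖ ^ 2 * gain (dir h) w := by
  rcases eq_or_ne h 0 with rfl | hh
  · simp [gain]
  · have : ‖h‖ ≠ 0 := norm_ne_zero_iff.2 hh
    rw [gain, gain, dir, inner_smul_left, norm_mul, RCLike.norm_conj, Complex.norm_real, norm_inv,
      norm_norm]
    field_simp

theorem gain_dir_self {N : ℕ} (h : Vec N) : gain h (dir h) = ‖h‖ ^ 2 := by
  rcases eq_or_ne h 0 with rfl | hh
  · simp [gain]
  · rw [gain_eq_norm_sq_mul_gain_dir, gain, inner_self_eq_norm_sq_to_K, norm_dir hh]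
    simp

/-- Replacing the unit vector `a` by `b` changes a gain by no more than the chordal distance of the
two lines allows. -/
theorem abs_gain_sub_gain_le {N : ℕ} (u : Vec N) {a b : Vec N} (ha : ‖a‖ = 1) (hb : ‖b‖ ≤ 1) :
    |gain u a - gain u b| ≤ 2 * ‖u‖ ^ 2 * √(2 * (1 - gain a b)) := by
  -- Gains ignore the phase of a beam, so `b` may be rotated until its inner product with `a` is
  -- real and nonnegative.
  obtain ⟨φ, hφ, hab⟩ : ∃ φ : ℂ, ‖φ‖ = 1 ∧ inner ℂ a (φ • b) = (‖inner ℂ a b‖ : ℂ) := by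
    rcases eq_or_ne (inner ℂ a b) 0 with h0 | h0
    · exact ⟨1, by simp, by simp [h0]⟩
    · have hn : (‖inner ℂ a b‖ : ℂ) ≠ 0 := by simpa using h0
      refine ⟨(starRingEnd ℂ) (inner ℂ a b) / ‖inner ℂ a b‖, ?_, ?_⟩
      · have : ‖inner ℂ a b‖ ≠ 0 := by simpa using h0
        rw [norm_div, RCLike.norm_conj, Complex.norm_real, norm_norm, div_self this]
      · rw [inner_smul_right, div_mul_eq_mul_div, RCLike.conj_mul, div_eq_iff hn]
        simp [sq]
  have hin : ‖inner ℂ a b‖ ≤ 1 := by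
    refine (norm_inner_le_norm a b).trans ?_
    rw [ha, one_mul]; exact hb
  -- With `t = ‖inner ℂ a b‖ ≤ 1`, the squared distance is at most `2 * (1 - t) ≤ 2 * (1 - t ^ 2)`.
  have hd : ‖a - φ • b‖ ≤ √(2 * (1 - gain a b)) := by
    refine Real.le_sqrt_of_sq_le ?_
    rw [norm_sub_sq (𝕜 := ℂ), hab, norm_smul, hφ, ha, gain]
    have : ‖b‖ ^ 2 ≤ 1 := pow_le_one₀ (norm_nonneg _) hb
    simp only [Complex.ofReal_re, RCLike.re_to_complex]
    nlinarith [norm_nonneg (inner ℂ a b)]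
  have hgb : gain u b = gain u (φ • b) := by
    rw [gain, gain, inner_smul_right, norm_mul, hφ, one_mul]
  have hφb : ‖φ • b‖ ≤ 1 := by rw [norm_smul, hφ, one_mul]; exact hb
  have h1 : ‖inner ℂ u a‖ ≤ ‖u‖ := by simpa [ha] using norm_inner_le_norm (𝕜 := ℂ) u a
  have h2 : ‖inner ℂ u (φ • b)‖ ≤ ‖u‖ :=
    (norm_inner_le_norm (𝕜 := ℂ) u _).trans (mul_le_of_le_one_right (norm_nonneg _) hφb)
  have h3 : |‖inner ℂ u a‖ - ‖inner ℂ u (φ • b)‖| ≤ ‖u‖ * ‖a - φ • b‖ := by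
    refine (abs_norm_sub_norm_le _ _).trans ?_
    rw [← inner_sub_right]
    exact norm_inner_le_norm _ _
  rw [hgb, gain, gain, sq_sub_sq, abs_mul, abs_of_nonneg (by positivity)]
  calc (‖inner ℂ u a‖ + ‖inner ℂ u (φ • b)‖) * |‖inner ℂ u a‖ - ‖inner ℂ u (φ • b)‖|
      ≤ (‖u‖ + ‖u‖) * (‖u‖ * √(2 * (1 - gain a b))) := by
        gcongr
        exact h3.trans (by gcongr)
    _ = _ := by ring

/-- The chordal quantization error of the channel direction `h / ‖h‖` by the beam `w`. -/
noncomputable def dirError {N : ℕ} (h w : Vec N) : ℝ := √(2 * (‖dir h‖ ^ 2 - gain (dir h) w))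

/-- Having `‖dir h‖ ^ 2` in the definition in place of `1` makes the error vanish at `h = 0`, so the
probabilistic estimates need no exception there. -/
theorem dirError_eq {N : ℕ} {h : Vec N} (hh : h ≠ 0) (w : Vec N) :
    dirError h w = √(2 * (1 - gain (dir h) w)) := by
  rw [dirError, norm_dir hh, one_pow]

theorem fullGains_nonneg {N : ℕ} (h₁ h₂ : Vec N) : (fullGains h₁ h₂).Nonneg :=
  ⟨sq_nonneg _, sq_nonneg _, gain_nonneg _ _, gain_nonneg _ _⟩

theorem trueGains_nonneg {N : ℕ} (h₁ h₂ w₁ w₂ : Vec N) : (trueGains h₁ h₂ w₁ w₂).Nonneg :=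
  ⟨gain_nonneg _ _, gain_nonneg _ _, gain_nonneg _ _, gain_nonneg _ _⟩

theorem estGains_nonneg {N B : ℕ} {δ : ℝ} (hδ : 0 < δ) (h₁ h₂ w₁ w₂ : Vec N) :
    (estGains B δ h₁ h₂ w₁ w₂).Nonneg :=
  have q := fun h w : Vec N => quantize_nonneg (B := B) hδ (gain_nonneg h w)
  ⟨q _ _, q _ _, mul_nonneg (q _ _) (gain_nonneg _ _), mul_nonneg (q _ _) (gain_nonneg _ _)⟩

theorem fullGains_boundedBy {N : ℕ} (h₁ h₂ : Vec N) :
    (fullGains h₁ h₂).BoundedBy (‖h₁‖ ^ 2 + ‖h₂‖ ^ 2) := by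
  have g1 := gain_le_of_norm_le (h := h₁) (norm_dir_le h₂)
  have g2 := gain_le_of_norm_le (h := h₂) (norm_dir_le h₁)
  have := sq_nonneg ‖h₁‖
  have := sq_nonneg ‖h₂‖
  refine ⟨?_, ?_, ?_, ?_⟩ <;> simp only [fullGains] <;> linarith

theorem abs_norm_sq_sub_gain_le {N : ℕ} {h w : Vec N} (hh : h ≠ 0) (hw : ‖w‖ ≤ 1) :
    |‖h‖ ^ 2 - gain h w| ≤ 2 * ‖h‖ ^ 2 * dirError h w := by
  have := abs_gain_sub_gain_le h (norm_dir hh) hw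
  rwa [gain_dir_self, ← dirError_eq hh] at this

theorem fullGains_close_trueGains {N : ℕ} {h₁ h₂ w₁ w₂ : Vec N} (hh₁ : h₁ ≠ 0) (hh₂ : h₂ ≠ 0)
    (hw₁ : ‖w₁‖ ≤ 1) (hw₂ : ‖w₂‖ ≤ 1) :
    (fullGains h₁ h₂).Close (trueGains h₁ h₂ w₁ w₂)
      (4 * (‖h₁‖ ^ 2 + ‖h₂‖ ^ 2) * (dirError h₁ w₁ + dirError h₂ w₂)) := by
  have e1 : 0 ≤ dirError h₁ w₁ := Real.sqrt_nonneg _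
  have e2 : 0 ≤ dirError h₂ w₂ := Real.sqrt_nonneg _
  have s1 := sq_nonneg ‖h₁‖
  have s2 := sq_nonneg ‖h₂‖
  have p1 := mul_nonneg s1 e1
  have p2 := mul_nonneg s1 e2
  have p3 := mul_nonneg s2 e1
  have p4 := mul_nonneg s2 e2
  refine ⟨(abs_norm_sq_sub_gain_le hh₁ hw₁).trans ?_, (abs_norm_sq_sub_gain_le hh₂ hw₂).trans ?_,
    (abs_gain_sub_gain_le h₁ (norm_dir hh₂) hw₂).trans ?_,
    (abs_gain_sub_gain_le h₂ (norm_dir hh₁) hw₁).trans ?_⟩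
  · nlinarith
  · nlinarith
  · rw [← dirError_eq hh₂]
    nlinarith
  · rw [← dirError_eq hh₁]
    nlinarith

theorem abs_norm_sq_sub_quantize_le {N B : ℕ} {δ : ℝ} {h w : Vec N} (hδ : 0 < δ) (hh : h ≠ 0)
    (hw : ‖w‖ ≤ 1) :
    |‖h‖ ^ 2 - quantize B δ (gain h w)| ≤
      δ + saturation B δ (gain h w) + 2 * ‖h‖ ^ 2 * dirError h w := by
  have h1 := abs_norm_sq_sub_gain_le hh hw
  have h2 := abs_quantize_sub_le (B := B) (x := gain h w) hδ
  rw [abs_le] at *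
  constructor <;> linarith [h1.1, h1.2, h2.1, h2.2]

/-- The estimate replaces three things: the squared norm by the quantized gain, and each of the two
directions by its beam. -/
theorem abs_gain_dir_sub_quantize_mul_gain_le {N B : ℕ} {δ : ℝ} {h h' w w' : Vec N} (hδ : 0 < δ)
    (hh : h ≠ 0) (hh' : h' ≠ 0) (hw : ‖w‖ ≤ 1) (hw' : ‖w'‖ ≤ 1) :
    |gain h (dir h') - quantize B δ (gain h w) * gain w w'| ≤
      δ + saturation B δ (gain h w) + 4 * ‖h‖ ^ 2 * (dirError h w + dirError h' w') := by
  have h1 := abs_norm_sq_sub_quantize_le (B := B) hδ hh hw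
  have h2 := abs_gain_sub_gain_le (dir h) (norm_dir hh') hw'
  have h3 := abs_gain_sub_gain_le w' (norm_dir hh) hw
  rw [gain_comm w', gain_comm w'] at h3
  rw [← dirError_eq hh', norm_dir hh] at h2
  rw [← dirError_eq hh] at h3
  have e1 : 0 ≤ dirError h w := Real.sqrt_nonneg _
  have e2 : 0 ≤ dirError h' w' := Real.sqrt_nonneg _
  have hw2 : ‖w'‖ ^ 2 ≤ 1 := pow_le_one₀ (norm_nonneg _) hw'
  have h4 : |gain (dir h) (dir h') - gain w w'| ≤ 2 * dirError h w + 2 * dirError h' w' := by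
    have h3' : |gain (dir h) w' - gain w w'| ≤ 2 * dirError h w := by
      refine h3.trans ?_
      nlinarith
    rw [abs_le] at *
    constructor <;> linarith [h2.1, h2.2, h3'.1, h3'.2]
  have hg1 : |gain w w'| ≤ 1 := by
    rw [abs_of_nonneg (gain_nonneg _ _)]
    exact (gain_le_of_norm_le hw').trans (pow_le_one₀ (norm_nonneg _) hw)
  rw [gain_eq_norm_sq_mul_gain_dir,
    show ‖h‖ ^ 2 * gain (dir h) (dir h') - quantize B δ (gain h w) * gain w w' =
      ‖h‖ ^ 2 * (gain (dir h) (dir h') - gain w w') +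
        (‖h‖ ^ 2 - quantize B δ (gain h w)) * gain w w' by ring]
  refine (abs_add_le _ _).trans ?_
  rw [abs_mul, abs_mul, abs_of_nonneg (sq_nonneg ‖h‖)]
  have i1 := mul_le_mul_of_nonneg_left h4 (sq_nonneg ‖h‖)
  have i2 := mul_le_mul h1 hg1 (abs_nonneg _) ((abs_nonneg _).trans h1)
  nlinarith [mul_nonneg (sq_nonneg ‖h‖) e2]

theorem fullGains_close_estGains {N B : ℕ} {δ : ℝ} {h₁ h₂ w₁ w₂ : Vec N} (hδ : 0 < δ)
    (hh₁ : h₁ ≠ 0) (hh₂ : h₂ ≠ 0) (hw₁ : ‖w₁‖ ≤ 1) (hw₂ : ‖w₂‖ ≤ 1) :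
    (fullGains h₁ h₂).Close (estGains B δ h₁ h₂ w₁ w₂)
      (δ + (saturation B δ (gain h₁ w₁) + saturation B δ (gain h₂ w₂)) +
        4 * (‖h₁‖ ^ 2 + ‖h₂‖ ^ 2) * (dirError h₁ w₁ + dirError h₂ w₂)) := by
  have e1 : 0 ≤ dirError h₁ w₁ := Real.sqrt_nonneg _
  have e2 : 0 ≤ dirError h₂ w₂ := Real.sqrt_nonneg _
  have s1 := sq_nonneg ‖h₁‖
  have s2 := sq_nonneg ‖h₂‖
  have p1 := mul_nonneg s1 e1
  have p2 := mul_nonneg s1 e2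
  have p3 := mul_nonneg s2 e1
  have p4 := mul_nonneg s2 e2
  have t1 := saturation_nonneg (B := B) (δ := δ) (x := gain h₁ w₁)
  have t2 := saturation_nonneg (B := B) (δ := δ) (x := gain h₂ w₂)
  refine ⟨(abs_norm_sq_sub_quantize_le hδ hh₁ hw₁).trans ?_,
    (abs_norm_sq_sub_quantize_le hδ hh₂ hw₂).trans ?_,
    (abs_gain_dir_sub_quantize_mul_gain_le hδ hh₁ hh₂ hw₁ hw₂).trans ?_,
    (abs_gain_dir_sub_quantize_mul_gain_le hδ hh₂ hh₁ hw₂ hw₁).trans ?_⟩ <;>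
  nlinarith

theorem abs_rateLoss_le {N B : ℕ} {P σ ε δ βstar βq : ℝ} {h₁ h₂ w₁ w₂ : Vec N} (hP : 0 < P)
    (hσ : 0 < σ) (hε : 0 < ε) (hδ : 0 < δ) (hw₁ : ‖w₁‖ ≤ 1) (hw₂ : ‖w₂‖ ≤ 1)
    (hs : IsOptimalAlloc P σ ε (fullGains h₁ h₂) βstar)
    (hq : IsOptimalAlloc P σ ε (estGains B δ h₁ h₂ w₁ w₂) βq) :
    |rateLoss P σ h₁ h₂ w₁ w₂ βstar βq| ≤
      4 * P / (σ ^ 2 * Real.log 2) * (3 + (2 + ε) * P / (ε * σ ^ 2)) *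
        ((1 + (‖h₁‖ ^ 2 + ‖h₂‖ ^ 2)) *
          (δ + (saturation B δ (gain h₁ w₁) + saturation B δ (gain h₂ w₂)) +
            4 * (‖h₁‖ ^ 2 + ‖h₂‖ ^ 2) * (dirError h₁ w₁ + dirError h₂ w₂))) := by
  -- Admissibility contains positivity of the direct gains, which excludes zero channels.
  have hh₁ : h₁ ≠ 0 := by
    rintro rfl
    simpa [fullGains] using hs.1.1
  have hh₂ : h₂ ≠ 0 := by
    rintro rfl
    simpa [fullGains] using hs.1.2.1
  have ct := fullGains_close_trueGains hh₁ hh₂ hw₁ hw₂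
  have t1 := saturation_nonneg (B := B) (δ := δ) (x := gain h₁ w₁)
  have t2 := saturation_nonneg (B := B) (δ := δ) (x := gain h₂ w₂)
  refine abs_optimal_sumRate_sub_le hP hσ hε (fullGains_nonneg _ _) (estGains_nonneg hδ _ _ _ _)
    (trueGains_nonneg _ _ _ _) (fullGains_boundedBy _ _)
    (fullGains_close_estGains hδ hh₁ hh₂ hw₁ hw₂) ?_ hs hq
  obtain ⟨c1, c2, c3, c4⟩ := ct
  refine ⟨c1.trans ?_, c2.trans ?_, c3.trans ?_, c4.trans ?_⟩ <;> linarith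

end MisoNoma

/-! ### Gaussian and isotropic laws, and the error of random vector quantization. -/

namespace MisoNoma

theorem measurable_ofReal_prod : Measurable (fun p : ℝ × ℝ => (⟨p.1, p.2⟩ : ℂ)) :=
  Complex.measurableEquivRealProd.symm.measurable

instance : IsProbabilityMeasure cnScalar :=
  Measure.isProbabilityMeasure_map measurable_ofReal_prod.aemeasurable

instance (N : ℕ) : IsProbabilityMeasure (cnVec N) :=
  Measure.isProbabilityMeasure_map (WithLp.measurable_toLp 2 _).aemeasurable

theorem measurable_dir {N : ℕ} : Measurable (dir : Vec N → Vec N) := by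
  unfold dir
  fun_prop

instance (N : ℕ) : IsProbabilityMeasure (isotropicUnit N) :=
  Measure.isProbabilityMeasure_map measurable_dir.aemeasurable

theorem continuous_gain {N : ℕ} : Continuous (fun p : Vec N × Vec N => gain p.1 p.2) := by
  unfold gain
  fun_prop

theorem aemeasurable_gain {Ω : Type*} [MeasurableSpace Ω] {μ : Measure Ω} {N : ℕ}
    {X Y : Ω → Vec N} (hX : AEMeasurable X μ) (hY : AEMeasurable Y μ) :
    AEMeasurable (fun ω => gain (X ω) (Y ω)) μ := by
  unfold gain
  exact (hX.inner hY).norm.pow_const 2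

theorem nullMeasurableSet_forall_gain_lt {Ω : Type*} [MeasurableSpace Ω] {μ : Measure Ω} {N n : ℕ}
    {X : Ω → Vec N} {code : Fin n → Ω → Vec N} (hX : AEMeasurable X μ)
    (hcode : ∀ i, AEMeasurable (code i) μ) (a : ℝ) :
    NullMeasurableSet {ω | ∀ i, gain (X ω) (code i ω) < a * ‖X ω‖ ^ 2} μ := by
  rw [Set.ofPred_forall]
  exact NullMeasurableSet.iInter fun i =>
    nullMeasurableSet_lt (aemeasurable_gain hX (hcode i)) (by fun_prop)

/-- Since `dir 0 = 0`, the inequality avoids showing that the Gaussian law does not charge `0`, and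
it suffices for the beams. -/
theorem ae_norm_le_one_isotropicUnit (N : ℕ) : ∀ᵐ c ∂isotropicUnit N, ‖c‖ ≤ 1 := by
  rw [isotropicUnit, ae_map_iff measurable_dir.aemeasurable
    (measurableSet_le measurable_norm measurable_const)]
  exact ae_of_all _ norm_dir_le

theorem memLp_id_cnScalar (p : NNReal) : MemLp id p cnScalar := by
  rw [cnScalar, memLp_map_measure_iff aestronglyMeasurable_id measurable_ofReal_prod.aemeasurable]
  set γ := gaussianReal 0 (1 / 2)
  have h1 : MemLp (fun q : ℝ × ℝ => (q.1 : ℂ)) p (γ.prod γ) :=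
    ((memLp_id_gaussianReal p).comp_measurePreserving measurePreserving_fst).ofReal
  have h2 : MemLp (fun q : ℝ × ℝ => (q.2 : ℂ)) p (γ.prod γ) :=
    ((memLp_id_gaussianReal p).comp_measurePreserving measurePreserving_snd).ofReal
  have h3 := h1.add (h2.const_mul Complex.I)
  refine h3.congr_norm measurable_ofReal_prod.aestronglyMeasurable (ae_of_all _ fun q => ?_)
  congr 1
  apply Complex.ext <;> simp

theorem memLp_id_cnVec (N : ℕ) (p : NNReal) : MemLp id p (cnVec N) := by
  have hm : Measurable (WithLp.toLp 2 : (Fin N → ℂ) → Vec N) := WithLp.measurable_toLp 2 _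
  rw [cnVec, memLp_map_measure_iff aestronglyMeasurable_id hm.aemeasurable]
  have h1 : MemLp (fun x : Fin N → ℂ => ∑ i, ‖x i‖) p (Measure.pi fun _ => cnScalar) :=
    memLp_finsetSum _ fun i _ =>
      ((memLp_id_cnScalar p).comp_measurePreserving (measurePreserving_eval _ i)).norm
  refine h1.mono hm.aestronglyMeasurable (ae_of_all _ fun x => ?_)
  rw [Real.norm_of_nonneg (Finset.sum_nonneg fun _ _ => norm_nonneg _)]
  refine abs_le_of_sq_le_sq' ?_ (Finset.sum_nonneg fun _ _ => norm_nonneg _) |>.2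
  simp only [Function.comp_apply, id_eq]
  rw [EuclideanSpace.norm_sq_eq]
  exact Finset.sum_sq_le_sq_sum_of_nonneg fun _ _ => norm_nonneg _

theorem gaussianPDFReal_half_le {y : ℝ} (hy : |y| ≤ 2) :
    gaussianPDFReal 0 (1 / 2) 2 ≤ gaussianPDFReal 0 (1 / 2) y := by
  unfold gaussianPDFReal
  have : y ^ 2 ≤ 2 ^ 2 := sq_le_sq' (abs_le.1 hy).1 (abs_le.1 hy).2
  refine mul_le_mul_of_nonneg_left (Real.exp_le_exp.2 ?_) (by positivity)
  refine div_le_div_of_nonneg_right ?_ (by positivity)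
  simp only [sub_zero]
  linarith

/-- The interval stays inside `[-2, 2]`, where the density is at least its value at `2`. -/
theorem le_gaussianReal_Icc {x s : ℝ} (hx : |x| ≤ 1) (hs1 : s ≤ 1) :
    ENNReal.ofReal (gaussianPDFReal 0 (1 / 2) 2 * (2 * s)) ≤
      gaussianReal 0 (1 / 2) (Set.Icc (x - s) (x + s)) := by
  rw [gaussianReal_apply _ (by norm_num)]
  calc ENNReal.ofReal (gaussianPDFReal 0 (1 / 2) 2 * (2 * s))
      = ∫⁻ _ in Set.Icc (x - s) (x + s), ENNReal.ofReal (gaussianPDFReal 0 (1 / 2) 2) := by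
        rw [setLIntegral_const, Real.volume_Icc, ENNReal.ofReal_mul (gaussianPDFReal_nonneg _ _ _)]
        congr 2
        ring
    _ ≤ _ := by
        refine setLIntegral_mono' measurableSet_Icc fun y hy => ?_
        refine ENNReal.ofReal_le_ofReal (gaussianPDFReal_half_le ?_)
        rw [abs_le] at *
        constructor <;> linarith [hx.1, hx.2, hy.1, hy.2]

theorem le_cnScalar_box {z : ℂ} {s : ℝ} (hz : ‖z‖ ≤ 1) (hs : 0 ≤ s) (hs1 : s ≤ 1) :
    ENNReal.ofReal ((gaussianPDFReal 0 (1 / 2) 2 * (2 * s)) ^ 2) ≤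
      cnScalar {w | |w.re - z.re| ≤ s ∧ |w.im - z.im| ≤ s} := by
  refine le_trans ?_ (Measure.le_map_apply measurable_ofReal_prod.aemeasurable _)
  have hset : (fun p : ℝ × ℝ => (⟨p.1, p.2⟩ : ℂ)) ⁻¹'
      {w | |w.re - z.re| ≤ s ∧ |w.im - z.im| ≤ s} =
      Set.Icc (z.re - s) (z.re + s) ×ˢ Set.Icc (z.im - s) (z.im + s) := by
    ext p
    simp only [Set.mem_preimage, Set.mem_ofPred_eq, Set.mem_prod, Set.mem_Icc, abs_le]
    constructor <;> rintro ⟨⟨_, _⟩, _, _⟩ <;> refine ⟨⟨?_, ?_⟩, ?_, ?_⟩ <;> linarith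
  have hd : 0 ≤ gaussianPDFReal 0 (1 / 2) 2 := gaussianPDFReal_nonneg _ _ _
  rw [hset, Measure.prod_prod, sq, ENNReal.ofReal_mul (by positivity)]
  exact mul_le_mul' (le_gaussianReal_Icc ((Complex.abs_re_le_norm z).trans hz) hs1)
    (le_gaussianReal_Icc ((Complex.abs_im_le_norm z).trans hz) hs1)

theorem le_cnVec_box {N : ℕ} {u : Vec N} {s : ℝ} (hu : ‖u‖ ≤ 1) (hs : 0 ≤ s) (hs1 : s ≤ 1) :
    ENNReal.ofReal ((gaussianPDFReal 0 (1 / 2) 2 * (2 * s)) ^ (2 * N)) ≤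
      cnVec N {g | ∀ i, |(g i).re - (u i).re| ≤ s ∧ |(g i).im - (u i).im| ≤ s} := by
  refine le_trans ?_ (Measure.le_map_apply (WithLp.measurable_toLp 2 _).aemeasurable _)
  have hset : WithLp.toLp 2 ⁻¹'
      {g : Vec N | ∀ i, |(g i).re - (u i).re| ≤ s ∧ |(g i).im - (u i).im| ≤ s} =
      Set.univ.pi fun i => {w | |w.re - (u i).re| ≤ s ∧ |w.im - (u i).im| ≤ s} := by
    ext g
    simp [Set.mem_pi]
  rw [hset, Measure.pi_pi, pow_mul, ENNReal.ofReal_pow (sq_nonneg _)]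
  calc _ = ∏ _i : Fin N, ENNReal.ofReal ((gaussianPDFReal 0 (1 / 2) 2 * (2 * s)) ^ 2) := by simp
    _ ≤ _ := Finset.prod_le_prod' fun i _ =>
      le_cnScalar_box ((PiLp.norm_apply_le u i).trans hu) hs hs1

theorem norm_sub_sq_le_of_mem_box {N : ℕ} {u g : Vec N} {s : ℝ}
    (h : ∀ i, |(g i).re - (u i).re| ≤ s ∧ |(g i).im - (u i).im| ≤ s) :
    ‖g - u‖ ^ 2 ≤ N * (2 * s ^ 2) := by
  rw [EuclideanSpace.norm_sq_eq]
  calc ∑ i, ‖(g - u) i‖ ^ 2 ≤ ∑ _i : Fin N, 2 * s ^ 2 := by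
        refine Finset.sum_le_sum fun i _ => ?_
        obtain ⟨h1, h2⟩ := h i
        rw [← Complex.normSq_eq_norm_sq, Complex.normSq_apply]
        simp only [PiLp.sub_apply, Complex.sub_re, Complex.sub_im]
        have a1 := sq_le_sq' (abs_le.1 h1).1 (abs_le.1 h1).2
        have a2 := sq_le_sq' (abs_le.1 h2).1 (abs_le.1 h2).2
        linarith
    _ = _ := by simp

/-- The part of `g` orthogonal to `u` satisfies `‖g‖² - |z|² ≤ ‖g - u‖²`, the difference being `|z -
1|²`. This is at most `r² / 4 ≤ r² * ‖g‖²`, because `‖g‖ ≥ 1 / 2`. -/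
theorem gain_dir_ge_of_near {N : ℕ} {u g : Vec N} {r : ℝ} (hu : ‖u‖ = 1) (hr1 : r ≤ 1)
    (h : ‖g - u‖ ≤ r / 2) : 1 - r ^ 2 ≤ gain u (dir g) := by
  have hg : 1 / 2 ≤ ‖g‖ := by
    have := norm_sub_norm_le u g
    rw [norm_sub_rev, hu] at this
    linarith
  have e := norm_sub_sq (𝕜 := ℂ) g u
  rw [gain_comm, show gain (dir g) u = gain g u / ‖g‖ ^ 2 by
    rw [gain_eq_norm_sq_mul_gain_dir g u]; field_simp, le_div_iff₀ (by positivity), gain]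
  set z : ℂ := inner ℂ g u
  have hz : ‖z‖ ^ 2 = z.re ^ 2 + z.im ^ 2 := by
    rw [← Complex.normSq_eq_norm_sq, Complex.normSq_apply]; ring
  have h2 : ‖g - u‖ ^ 2 ≤ (r / 2) ^ 2 := by gcongr
  rw [hu] at e
  simp only [RCLike.re_to_complex] at e
  have hg2 : (1 / 2) ^ 2 ≤ ‖g‖ ^ 2 := by gcongr
  nlinarith [sq_nonneg (z.re - 1), sq_nonneg z.im, sq_nonneg r]

/-- A spherical-cap estimate for the isotropic law: a codeword is within `r` of a given line with
probability at least of order `r ^ (2 N)`. -/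
theorem exists_isotropicUnit_gain_lt_le {N : ℕ} (hN : 0 < N) :
    ∃ κ : ℝ, 0 < κ ∧ ∀ (r : ℝ) (x : Vec N), 0 < r → r ≤ 1 →
      isotropicUnit N {c | gain x c < (1 - r ^ 2) * ‖x‖ ^ 2} ≤
        ENNReal.ofReal (1 - κ * r ^ (2 * N)) := by
  set d := gaussianPDFReal 0 (1 / 2) 2 with hd
  have hd0 : 0 < d := gaussianPDFReal_pos _ _ _ (by norm_num)
  have hN' : (1 : ℝ) ≤ N := by exact_mod_cast hN
  -- A box of half-side `r / (4 * N)` around `dir x` lies within `r / 2` of it. Each of its `2 * N`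
  -- real sides has Gaussian mass at least `d * r / (2 * N)`.
  refine ⟨(d / (2 * N)) ^ (2 * N), by positivity, fun r x hr hr1 => ?_⟩
  have hgood : ENNReal.ofReal ((d / (2 * N)) ^ (2 * N) * r ^ (2 * N)) ≤
      isotropicUnit N {c | (1 - r ^ 2) * ‖x‖ ^ 2 ≤ gain x c} := by
    refine le_trans ?_ (Measure.le_map_apply measurable_dir.aemeasurable _)
    have hs0 : 0 ≤ r / (4 * N) := by positivity
    have hs1 : r / (4 * N) ≤ 1 := by
      rw [div_le_one (by positivity)]; linarith
    have hb := le_cnVec_box (norm_dir_le x) hs0 hs1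
    rw [← hd, show d * (2 * (r / (4 * N))) = d / (2 * N) * r by field_simp; ring, mul_pow] at hb
    refine hb.trans (measure_mono fun g hg => ?_)
    rw [Set.mem_preimage, Set.mem_ofPred_eq]
    rcases eq_or_ne x 0 with rfl | hx
    · simp [gain]
    · rw [gain_eq_norm_sq_mul_gain_dir, mul_comm]
      refine mul_le_mul_of_nonneg_left ?_ (sq_nonneg _)
      refine gain_dir_ge_of_near (norm_dir hx) hr1 ?_
      refine abs_le_of_sq_le_sq' ?_ (by positivity) |>.2
      refine (norm_sub_sq_le_of_mem_box hg).trans ?_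
      rw [show (N : ℝ) * (2 * (r / (4 * N)) ^ 2) = r ^ 2 / (8 * N) by field_simp; ring, div_pow]
      gcongr
      linarith
  have hmeas : MeasurableSet {c : Vec N | (1 - r ^ 2) * ‖x‖ ^ 2 ≤ gain x c} :=
    measurableSet_le measurable_const
      (continuous_gain.comp (by fun_prop : Continuous fun c : Vec N => (x, c))).measurable
  have hcompl : {c : Vec N | gain x c < (1 - r ^ 2) * ‖x‖ ^ 2} =
      {c | (1 - r ^ 2) * ‖x‖ ^ 2 ≤ gain x c}ᶜ := by
    ext c; simp
  rw [hcompl, prob_compl_eq_one_sub hmeas, ENNReal.ofReal_sub _ (by positivity), ENNReal.ofReal_one]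
  exact tsub_le_tsub_left hgood 1

/-- If each of `n` independent codewords misses every channel with probability at most `q`, all of
them miss an independent random channel with probability at most `q ^ n`. -/
theorem measure_forall_gain_lt_le {Ω : Type*} [MeasurableSpace Ω] {μ : Measure Ω}
    [IsProbabilityMeasure μ] {N n : ℕ} {X : Ω → Vec N} {code : Fin n → Ω → Vec N} {a : ℝ}
    {q : ENNReal} (hX : AEMeasurable X μ) (hcode : ∀ i, HasLaw (code i) (isotropicUnit N) μ)
    (hi : iIndepFun code μ) (hXc : IndepFun X (fun ω i => code i ω) μ)
    (hq : ∀ x, isotropicUnit N {c | gain x c < a * ‖x‖ ^ 2} ≤ q) :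
    μ {ω | ∀ i, gain (X ω) (code i ω) < a * ‖X ω‖ ^ 2} ≤ q ^ n := by
  have hXlaw : HasLaw X (μ.map X) μ := ⟨hX, rfl⟩
  have := hXlaw.isProbabilityMeasure_iff.1 inferInstance
  have hpair := hXc.hasLaw_prod hXlaw (hi.hasLaw_pi hcode)
  have hA : MeasurableSet {p : Vec N × (Fin n → Vec N) | ∀ i, gain p.1 (p.2 i) < a * ‖p.1‖ ^ 2} := by
    rw [Set.ofPred_forall]
    refine MeasurableSet.iInter fun i => measurableSet_lt ?_ (by fun_prop)
    exact (continuous_gain.comp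
      (by fun_prop : Continuous fun p : Vec N × (Fin n → Vec N) => (p.1, p.2 i))).measurable
  rw [hpair.measure_eq (p := fun p => ∀ i, gain p.1 (p.2 i) < a * ‖p.1‖ ^ 2) hA,
    Measure.prod_apply hA]
  calc _ ≤ ∫⁻ _, q ^ n ∂(μ.map X) := by
        refine lintegral_mono fun x => ?_
        -- For a fixed channel the event is a product set, so the codewords factor.
        have : Prod.mk x ⁻¹' {p : Vec N × (Fin n → Vec N) | ∀ i, gain p.1 (p.2 i) < a * ‖p.1‖ ^ 2} =
            Set.univ.pi fun _ => {c | gain x c < a * ‖x‖ ^ 2} := by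
          ext c; simp [Set.mem_pi]
        rw [this, Measure.pi_pi]
        calc _ ≤ ∏ _i : Fin n, q := Finset.prod_le_prod' fun _ _ => hq x
          _ = _ := by simp
    _ = q ^ n := by simp

theorem dirError_sq_le {N : ℕ} (h w : Vec N) : dirError h w ^ 2 ≤ 2 := by
  rw [dirError]
  have h1 : ‖dir h‖ ^ 2 ≤ 1 := pow_le_one₀ (norm_nonneg _) (norm_dir_le h)
  have h2 := gain_nonneg (dir h) w
  rcases le_or_gt 0 (2 * (‖dir h‖ ^ 2 - gain (dir h) w)) with h0 | h0
  · rw [Real.sq_sqrt h0]; linarith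
  · rw [Real.sqrt_eq_zero_of_nonpos h0.le]; norm_num

theorem dirError_sq_le_of_gain_ge {N : ℕ} {h w : Vec N} {r : ℝ}
    (hg : (1 - r ^ 2) * ‖h‖ ^ 2 ≤ gain h w) : dirError h w ^ 2 ≤ 2 * r ^ 2 := by
  rw [dirError]
  rcases le_or_gt 0 (2 * (‖dir h‖ ^ 2 - gain (dir h) w)) with h0 | h0
  · rw [Real.sq_sqrt h0]
    rcases eq_or_ne h 0 with rfl | hh
    · simp [dir, gain, sq_nonneg]
    · have hp : 0 < ‖h‖ ^ 2 := by have := norm_pos_iff.2 hh; positivity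
      rw [gain_eq_norm_sq_mul_gain_dir, mul_comm] at hg
      have := le_of_mul_le_mul_left hg hp
      rw [norm_dir hh]
      linarith
  · rw [Real.sqrt_eq_zero_of_nonpos h0.le]
    nlinarith [sq_nonneg r]

/-- Weakening `exp (-n * y)` to a reciprocal suffices, since the miss probability only has to match
`r ^ 2`. -/
theorem one_sub_pow_le_one_div {y : ℝ} (hy : 0 < y) (hy1 : y ≤ 1) {n : ℕ} (hn : 0 < n) :
    (1 - y) ^ n ≤ 1 / (n * y) := by
  have hn' : (0 : ℝ) < n := by exact_mod_cast hn
  calc (1 - y) ^ n ≤ Real.exp (-y) ^ n := by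
        exact pow_le_pow_left₀ (by linarith) (by linarith [Real.add_one_le_exp (-y)]) _
    _ = 1 / Real.exp (n * y) := by
        rw [← Real.exp_nat_mul, one_div, ← Real.exp_neg, mul_neg]
    _ ≤ 1 / (n * y) := by
        gcongr
        linarith [Real.add_one_le_exp (n * y)]

/-- The mean-square error of random vector quantization decays exponentially in the number of
feedback bits. -/
theorem exists_integral_dirError_sq_le {N : ℕ} (hN : 0 < N) :
    ∃ A : ℝ, 0 < A ∧ ∀ (B' : ℕ) (Ω : Type*) [MeasurableSpace Ω] (μ : Measure Ω)
      [IsProbabilityMeasure μ] (X : Ω → Vec N) (code : Fin (2 ^ B') → Ω → Vec N)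
      (j : Ω → Fin (2 ^ B')), AEMeasurable X μ →
      (∀ i, HasLaw (code i) (isotropicUnit N) μ) → iIndepFun code μ →
      IndepFun X (fun ω i => code i ω) μ →
      (∀ ω i, gain (X ω) (code i ω) ≤ gain (X ω) (code (j ω) ω)) →
      ∫ ω, dirError (X ω) (code (j ω) ω) ^ 2 ∂μ ≤
        A * ((2 : ℝ) ^ (-(1 / (4 * N) * (B' : ℝ)))) ^ 2 := by
  obtain ⟨κ, hκ, hcap⟩ := exists_isotropicUnit_gain_lt_le hN
  refine ⟨2 + 2 / κ, by positivity, fun B' Ω _ μ _ X code j hX hcode hi hXc hmax => ?_⟩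
  have hN' : (0 : ℝ) < N := by exact_mod_cast hN
  -- Chosen so that `2 ^ B' * r ^ (4 * N) = 1`; then `1 / (2 ^ B' * κ * r ^ (2 * N))` equals `r ^ (2
  -- * N) / κ`.
  set r : ℝ := (2 : ℝ) ^ (-(1 / (4 * N) * (B' : ℝ))) with hr
  have hr0 : 0 < r := by positivity
  have hr1 : r ≤ 1 := by
    refine Real.rpow_le_one_of_one_le_of_nonpos one_le_two ?_
    have : 0 ≤ 1 / (4 * (N : ℝ)) * (B' : ℝ) := by positivity
    linarith
  have hrn : (2 : ℝ) ^ B' * (r ^ (2 * N) * r ^ (2 * N)) = 1 := by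
    rw [← pow_add, hr, ← Real.rpow_natCast _ (2 * N + 2 * N), ← Real.rpow_mul zero_le_two,
      ← Real.rpow_natCast 2 B', ← Real.rpow_add zero_lt_two]
    convert Real.rpow_zero 2 using 2
    push_cast
    field_simp
    ring
  set bad : Set Ω := {ω | ∀ i, gain (X ω) (code i ω) < (1 - r ^ 2) * ‖X ω‖ ^ 2} with hbad
  have hbadm : NullMeasurableSet bad μ :=
    nullMeasurableSet_forall_gain_lt hX (fun i => (hcode i).aemeasurable) _
  have hbadμ : μ.real bad ≤ r ^ 2 / κ := by
    have h1 : μ bad ≤ ENNReal.ofReal (1 - κ * r ^ (2 * N)) ^ (2 ^ B') :=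
      measure_forall_gain_lt_le hX hcode hi hXc fun x => hcap r x hr0 hr1
    rcases le_or_gt (κ * r ^ (2 * N)) 1 with hle | hgt
    · rw [← ENNReal.ofReal_pow (by linarith)] at h1
      have h2 : μ.real bad ≤ (1 - κ * r ^ (2 * N)) ^ (2 ^ B') :=
        ENNReal.toReal_le_of_le_ofReal (pow_nonneg (by linarith) _) h1
      refine h2.trans ((one_sub_pow_le_one_div (by positivity) hle (by positivity)).trans ?_)
      rw [div_le_div_iff₀ (by positivity) hκ]
      have h3 : r ^ (2 * N) ≤ r ^ 2 := pow_le_pow_of_le_one hr0.le hr1 (by omega)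
      calc 1 * κ = κ * ((2 : ℝ) ^ B' * (r ^ (2 * N) * r ^ (2 * N))) := by rw [hrn]; ring
        _ ≤ κ * ((2 : ℝ) ^ B' * (r ^ 2 * r ^ (2 * N))) := by gcongr
        _ = _ := by push_cast; ring
    -- Here `ENNReal.ofReal` truncates the bound to `0`, so the bad event is null.
    · rw [ENNReal.ofReal_of_nonpos (by linarith), zero_pow (by positivity)] at h1
      rw [measureReal_def, le_antisymm h1 zero_le, ENNReal.toReal_zero]
      positivity
  have hint : Integrable (bad.indicator fun _ => (2 : ℝ)) μ :=
    (integrable_const 2).indicator₀ hbadm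
  -- Outside `bad` some codeword, hence the selected one, has squared error at most `2 * r ^ 2`; on
  -- `bad` the trivial bound `2` is used.
  calc ∫ ω, dirError (X ω) (code (j ω) ω) ^ 2 ∂μ
      ≤ ∫ ω, (2 * r ^ 2 + bad.indicator (fun _ => (2 : ℝ)) ω) ∂μ := by
        refine integral_mono_of_nonneg (ae_of_all _ fun _ => sq_nonneg _)
          ((integrable_const _).add hint) (ae_of_all _ fun ω => ?_)
        by_cases hω : ω ∈ bad
        · simp only [Set.indicator_of_mem hω]
          have := dirError_sq_le (X ω) (code (j ω) ω)
          nlinarith [sq_nonneg r]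
        · simp only [Set.indicator_of_notMem hω, add_zero]
          simp only [hbad, Set.mem_ofPred_eq, not_forall, not_lt] at hω
          obtain ⟨i, hi⟩ := hω
          exact dirError_sq_le_of_gain_ge (hi.trans (hmax ω i))
    _ = 2 * r ^ 2 + 2 * μ.real bad := by
        rw [integral_add (integrable_const _) hint, integral_indicator₀ hbadm]
        simp [mul_comm]
    _ ≤ 2 * r ^ 2 + 2 * (r ^ 2 / κ) := by gcongr
    _ = _ := by ring

end MisoNoma

/-! ### Integral inequalities, moments and measurability for the system. -/

namespace MisoNoma

section Integrals

variable {Ω : Type*} [MeasurableSpace Ω] {μ : Measure Ω}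

/-- The set `s` may be arbitrary: it is enough that `{|f| ≤ g}` is null measurable, so measurability
of the feasible region is never needed. -/
theorem integrableOn_and_setIntegral_abs_le {f g : Ω → ℝ} {s : Set Ω} (hf : AEMeasurable f μ)
    (hg : Integrable g μ) (hg0 : 0 ≤ g) (hfg : ∀ᵐ ω ∂μ, ω ∈ s → |f ω| ≤ g ω) :
    IntegrableOn f s μ ∧ ∫ ω in s, |f ω| ∂μ ≤ ∫ ω, g ω ∂μ := by
  have hle : ∀ᵐ ω ∂μ.restrict s, |f ω| ≤ g ω := by
    refine (ae_restrict_iff₀ ?_).2 hfg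
    exact (nullMeasurableSet_le hf.abs hg.aemeasurable).mono_ac Measure.absolutelyContinuous_restrict
  have hint : IntegrableOn f s μ := hg.integrableOn.mono' hf.restrict.aestronglyMeasurable hle
  exact ⟨hint, (integral_mono_ae hint.abs hg.integrableOn hle).trans
    (setIntegral_le_integral hg (ae_of_all _ hg0))⟩

theorem integral_mul_le_sqrt_mul_sqrt {f g : Ω → ℝ} (hf0 : 0 ≤ f) (hg0 : 0 ≤ g)
    (hf : MemLp f 2 μ) (hg : MemLp g 2 μ) :
    ∫ ω, f ω * g ω ∂μ ≤ √(∫ ω, f ω ^ 2 ∂μ) * √(∫ ω, g ω ^ 2 ∂μ) := by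
  have h := integral_mul_le_Lp_mul_Lq_of_nonneg (μ := μ) Real.HolderConjugate.two_two
    (ae_of_all _ hf0) (ae_of_all _ hg0) (by simpa using hf) (by simpa using hg)
  simpa [Real.sqrt_eq_rpow] using h

/-- Assuming `1 ≤ A` gives `√A ≤ A`, so a single constant serves all terms. -/
theorem integral_mul_le_of_integral_sq_le {f g : Ω → ℝ} {A : ℝ} (hf0 : 0 ≤ f) (hg0 : 0 ≤ g)
    (hf : MemLp f 2 μ) (hg : MemLp g 2 μ) (hA : 1 ≤ A) (hfA : ∫ ω, f ω ^ 2 ∂μ ≤ A) :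
    ∫ ω, f ω * g ω ∂μ ≤ A * √(∫ ω, g ω ^ 2 ∂μ) := by
  refine (integral_mul_le_sqrt_mul_sqrt hf0 hg0 hf hg).trans ?_
  gcongr
  refine (Real.sqrt_le_sqrt hfA).trans ?_
  rw [Real.sqrt_le_left (by linarith)]
  nlinarith

end Integrals

theorem memLp_norm_of_hasLaw {Ω : Type*} [MeasurableSpace Ω] {μ : Measure Ω} {N : ℕ}
    {X : Ω → Vec N} (hX : HasLaw X (cnVec N) μ) (p : NNReal) : MemLp (fun ω => ‖X ω‖) p μ := by
  have h := memLp_id_cnVec N p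
  rw [← hX.map_eq, memLp_map_measure_iff aestronglyMeasurable_id hX.aemeasurable] at h
  exact h.norm

/-- The fourth power is what Cauchy–Schwarz requires for the terms `Y ^ 2 * e`. -/
theorem exists_integral_one_add_norm_sq_pow_four_le (N : ℕ) :
    ∃ A : ℝ, 1 ≤ A ∧ ∀ (Ω : Type*) [MeasurableSpace Ω] (μ : Measure Ω) [IsProbabilityMeasure μ]
      (X Y : Ω → Vec N), HasLaw X (cnVec N) μ → HasLaw Y (cnVec N) μ →
      Integrable (fun ω => (1 + (‖X ω‖ ^ 2 + ‖Y ω‖ ^ 2)) ^ 4) μ ∧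
        ∫ ω, (1 + (‖X ω‖ ^ 2 + ‖Y ω‖ ^ 2)) ^ 4 ∂μ ≤ A := by
  set m := ∫ x, ‖x‖ ^ 8 ∂cnVec N
  have hm : 0 ≤ m := integral_nonneg fun x => by positivity
  refine ⟨27 * (1 + (m + m)), by linarith, fun Ω _ μ _ X Y hX hY => ?_⟩
  have moment : ∀ {X : Ω → Vec N}, HasLaw X (cnVec N) μ →
      Integrable (fun ω => ‖X ω‖ ^ 8) μ ∧ ∫ ω, ‖X ω‖ ^ 8 ∂μ = m := by
    intro X hX
    have hm8 : AEStronglyMeasurable (fun x : Vec N => ‖x‖ ^ 8) (cnVec N) := by fun_prop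
    refine ⟨?_, hX.integral_comp hm8⟩
    have := (memLp_norm_of_hasLaw hX 8).integrable_norm_pow (p := 8) (by norm_num)
    simpa using this
  obtain ⟨iX, eX⟩ := moment hX
  obtain ⟨iY, eY⟩ := moment hY
  have hXm := hX.aemeasurable
  have hYm := hY.aemeasurable
  have iXY : Integrable (fun ω => ‖X ω‖ ^ 8 + ‖Y ω‖ ^ 8) μ := iX.add iY
  have idom : Integrable (fun ω => 27 * (1 + (‖X ω‖ ^ 8 + ‖Y ω‖ ^ 8))) μ :=
    ((integrable_const 1).add iXY).const_mul 27
  have hle : ∀ ω, (1 + (‖X ω‖ ^ 2 + ‖Y ω‖ ^ 2)) ^ 4 ≤ 27 * (1 + (‖X ω‖ ^ 8 + ‖Y ω‖ ^ 8)) := by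
    intro ω
    generalize ha : ‖X ω‖ ^ 2 = a
    generalize hb : ‖Y ω‖ ^ 2 = b
    have ea : ‖X ω‖ ^ 8 = a ^ 4 := by rw [← ha]; ring
    have eb : ‖Y ω‖ ^ 8 = b ^ 4 := by rw [← hb]; ring
    rw [ea, eb]
    have h1 : (1 + (a + b)) ^ 2 ≤ 3 * (1 + a ^ 2 + b ^ 2) := by
      nlinarith [sq_nonneg (a - b), sq_nonneg (a - 1), sq_nonneg (b - 1)]
    have h2 : (1 + a ^ 2 + b ^ 2) ^ 2 ≤ 3 * (1 + a ^ 4 + b ^ 4) := by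
      nlinarith [sq_nonneg (a ^ 2 - b ^ 2), sq_nonneg (a ^ 2 - 1), sq_nonneg (b ^ 2 - 1)]
    calc (1 + (a + b)) ^ 4 = ((1 + (a + b)) ^ 2) ^ 2 := by ring
      _ ≤ (3 * (1 + a ^ 2 + b ^ 2)) ^ 2 := by gcongr
      _ ≤ 27 * (1 + (a ^ 4 + b ^ 4)) := by nlinarith
  refine ⟨idom.mono' (by fun_prop) (ae_of_all _ fun ω => ?_), ?_⟩
  · rw [Real.norm_of_nonneg (by positivity)]
    exact hle ω
  · calc _ ≤ ∫ ω, 27 * (1 + (‖X ω‖ ^ 8 + ‖Y ω‖ ^ 8)) ∂μ :=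
          integral_mono_of_nonneg (ae_of_all _ fun _ => by positivity) idom (ae_of_all _ hle)
      _ = _ := by
          rw [integral_const_mul, integral_add (integrable_const _) iXY,
            integral_add iX iY, eX, eY]
          simp

theorem indepFun_channel_code {Ω : Type*} [MeasurableSpace Ω] {μ : Measure Ω} {N n : ℕ}
    {h : Fin 2 → Ω → Vec N} {code : Fin n → Ω → Vec N} (hh : ∀ k, AEMeasurable (h k) μ)
    (hc : ∀ i, AEMeasurable (code i) μ) (hi : iIndepFun (Sum.elim h code) μ) (k : Fin 2) :
    IndepFun (h k) (fun ω i => code i ω) μ := by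
  classical
  have hm : ∀ s, AEMeasurable (Sum.elim h code s) μ := by
    rintro (k | i)
    exacts [hh k, hc i]
  have hd : Disjoint ({Sum.inl k} : Finset (Fin 2 ⊕ Fin n)) (Finset.univ.image Sum.inr) := by
    simp
  have hST := hi.indepFun_finset₀ _ _ hd hm
  have hφ : Measurable fun x : ({Sum.inl k} : Finset (Fin 2 ⊕ Fin n)) → Vec N =>
      x ⟨Sum.inl k, by simp⟩ := measurable_pi_apply _
  have hψ : Measurable fun (y : {x // x ∈ Finset.univ.image (Sum.inr : Fin n → Fin 2 ⊕ Fin n)} → Vec N)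
      (i : Fin n) => y ⟨Sum.inr i, by simp⟩ :=
    measurable_pi_lambda _ fun i => measurable_pi_apply _
  exact hST.comp hφ hψ

theorem aemeasurable_selected {Ω : Type*} [MeasurableSpace Ω] {μ : Measure Ω} {N n : ℕ}
    {code : Fin n → Ω → Vec N} {j : Ω → Fin n} (hc : ∀ i, AEMeasurable (code i) μ)
    (hj : AEMeasurable j μ) : AEMeasurable (fun ω => code (j ω) ω) μ := by
  have hev : Measurable (fun q : Fin n × (Fin n → Vec N) => q.2 q.1) :=
    measurable_from_prod_countable_right fun i => measurable_pi_apply i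
  exact hev.comp_aemeasurable (hj.prodMk (aemeasurable_pi_lambda _ hc))

theorem saturation_eq_zero {B : ℕ} {δ x : ℝ} (hx : x < (2 ^ B - 1) * δ) : saturation B δ x = 0 :=
  max_eq_left (by linarith)

section System

variable {Ω : Type*} [MeasurableSpace Ω] {μ : Measure Ω}
  {N B B' : ℕ} {P σ ε δ : ℝ} {h : Fin 2 → Ω → Vec N} {code : Fin (2 ^ B') → Ω → Vec N}
  {j : Fin 2 → Ω → Fin (2 ^ B')} {βstar βq : Ω → ℝ}

theorem IsSystem.aemeasurable_beam (hsys : IsSystem μ N B B' P σ ε δ h code j βstar βq)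
    (k : Fin 2) : AEMeasurable (fun ω => code (j k ω) ω) μ :=
  aemeasurable_selected (fun i => (hsys.law_code i).aemeasurable) (hsys.meas_index k)

theorem IsSystem.ae_norm_beam_le_one (hsys : IsSystem μ N B B' P σ ε δ h code j βstar βq)
    (k : Fin 2) : ∀ᵐ ω ∂μ, ‖code (j k ω) ω‖ ≤ 1 := by
  have hp : Measurable fun c : Vec N => ‖c‖ ≤ 1 :=
    measurableSet_setOfPred.1 (measurableSet_le measurable_norm measurable_const)
  have h1 : ∀ᵐ ω ∂μ, ∀ i, ‖code i ω‖ ≤ 1 :=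
    ae_all_iff.2 fun i => ((hsys.law_code i).ae_iff hp).2 (ae_norm_le_one_isotropicUnit N)
  filter_upwards [h1] with ω hω using hω _

theorem IsSystem.aemeasurable_rateLoss (hsys : IsSystem μ N B B' P σ ε δ h code j βstar βq) :
    AEMeasurable (fun ω => rateLoss P σ (h 0 ω) (h 1 ω) (code (j 0 ω) ω) (code (j 1 ω) ω)
      (βstar ω) (βq ω)) μ := by
  have hh := fun k => (hsys.law_channel k).aemeasurable
  have hd := fun k => measurable_dir.comp_aemeasurable (hh k)
  have hw := hsys.aemeasurable_beam
  have hs := hsys.meas_star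
  have hq := hsys.meas_q
  have n0 : AEMeasurable (fun ω => ‖h 0 ω‖ ^ 2) μ := (hh 0).norm.pow_const 2
  have n1 : AEMeasurable (fun ω => ‖h 1 ω‖ ^ 2) μ := (hh 1).norm.pow_const 2
  have f10 : AEMeasurable (fun ω => gain (h 1 ω) (dir (h 0 ω))) μ :=
    aemeasurable_gain (hh 1) (hd 0)
  have g00 := aemeasurable_gain (hh 0) (hw 0)
  have g11 := aemeasurable_gain (hh 1) (hw 1)
  have g10 := aemeasurable_gain (hh 1) (hw 0)
  simp only [rateLoss, sumRate, Real.logb, fullGains, trueGains]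
  fun_prop

theorem aemeasurable_dirError {X Y : Ω → Vec N} (hX : AEMeasurable X μ) (hY : AEMeasurable Y μ) :
    AEMeasurable (fun ω => dirError (X ω) (Y ω)) μ := by
  have hd : AEMeasurable (fun ω => dir (X ω)) μ := measurable_dir.comp_aemeasurable hX
  have hg := aemeasurable_gain hd hY
  unfold dirError
  fun_prop

theorem memLp_dirError [IsFiniteMeasure μ] {X Y : Ω → Vec N} (hX : AEMeasurable X μ) (hY : AEMeasurable Y μ) :
    MemLp (fun ω => dirError (X ω) (Y ω)) 2 μ := by
  have hm := aemeasurable_dirError hX hY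
  refine (memLp_two_iff_integrable_sq hm.aestronglyMeasurable).2 ?_
  refine (integrable_const (2 : ℝ)).mono' (hm.pow_const 2).aestronglyMeasurable
    (ae_of_all _ fun ω => ?_)
  rw [Real.norm_of_nonneg (sq_nonneg _)]
  exact dirError_sq_le _ _

theorem IsSystem.memLp_saturation (hsys : IsSystem μ N B B' P σ ε δ h code j βstar βq)
    (hδ : 0 < δ) (k : Fin 2) :
    MemLp (fun ω => saturation B δ (gain (h k ω) (code (j k ω) ω))) 2 μ := by
  have hg := aemeasurable_gain (hsys.law_channel k).aemeasurable (hsys.aemeasurable_beam k)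
  have hsm : AEMeasurable (fun ω => saturation B δ (gain (h k ω) (code (j k ω) ω))) μ := by
    unfold saturation
    fun_prop
  have h4 := (memLp_norm_of_hasLaw (hsys.law_channel k) 4).integrable_norm_pow (p := 4)
    (by norm_num)
  refine (memLp_two_iff_integrable_sq hsm.aestronglyMeasurable).2 ?_
  refine h4.mono' (hsm.pow_const 2).aestronglyMeasurable ?_
  filter_upwards [hsys.ae_norm_beam_le_one k] with ω hω
  have h1 := (saturation_le (B := B) hδ (gain_nonneg (h k ω) (code (j k ω) ω))).trans
    (gain_le_of_norm_le hω)
  rw [Real.norm_of_nonneg (sq_nonneg _), norm_norm]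
  calc _ ≤ (‖h k ω‖ ^ 2) ^ 2 := pow_le_pow_left₀ saturation_nonneg h1 2
    _ = _ := by ring

/-- The expectation of a bound of the shape delivered by `abs_rateLoss_le`. -/
theorem integrable_and_integral_bound_le [IsFiniteMeasure μ] {A K δ : ℝ} {Y e₁ e₂ s₁ s₂ : Ω → ℝ} (hA : 1 ≤ A)
    (hK : 0 ≤ K) (hδ : 0 ≤ δ) (hYm : AEMeasurable Y μ) (hY : ∀ ω, 1 ≤ Y ω)
    (hY4 : Integrable (fun ω => Y ω ^ 4) μ) (hYA : ∫ ω, Y ω ^ 4 ∂μ ≤ A)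
    (he₁ : 0 ≤ e₁) (he₂ : 0 ≤ e₂) (hs₁ : 0 ≤ s₁) (hs₂ : 0 ≤ s₂)
    (me₁ : MemLp e₁ 2 μ) (me₂ : MemLp e₂ 2 μ) (ms₁ : MemLp s₁ 2 μ) (ms₂ : MemLp s₂ 2 μ) :
    Integrable (fun ω => K * (Y ω * δ + (Y ω * s₁ ω + Y ω * s₂ ω) +
        4 * (Y ω ^ 2 * e₁ ω + Y ω ^ 2 * e₂ ω))) μ ∧
      ∫ ω, K * (Y ω * δ + (Y ω * s₁ ω + Y ω * s₂ ω) +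
        4 * (Y ω ^ 2 * e₁ ω + Y ω ^ 2 * e₂ ω)) ∂μ ≤
      K * (A * δ + (A * √(∫ ω, s₁ ω ^ 2 ∂μ) + A * √(∫ ω, s₂ ω ^ 2 ∂μ)) +
        4 * (A * √(∫ ω, e₁ ω ^ 2 ∂μ) + A * √(∫ ω, e₂ ω ^ 2 ∂μ))) := by
  have hY0 : 0 ≤ Y := fun ω => zero_le_one.trans (hY ω)
  have hY20 : 0 ≤ fun ω => Y ω ^ 2 := fun ω => sq_nonneg _
  have le4 : ∀ ω, Y ω ≤ Y ω ^ 4 := fun ω => le_self_pow₀ (hY ω) (by norm_num)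
  have le24 : ∀ ω, Y ω ^ 2 ≤ Y ω ^ 4 := fun ω => pow_le_pow_right₀ (hY ω) (by norm_num)
  have mY : MemLp Y 2 μ := by
    refine (memLp_two_iff_integrable_sq hYm.aestronglyMeasurable).2 ?_
    refine hY4.mono' (hYm.pow_const 2).aestronglyMeasurable (ae_of_all _ fun ω => ?_)
    rw [Real.norm_of_nonneg (sq_nonneg _)]
    exact le24 ω
  have mY2 : MemLp (fun ω => Y ω ^ 2) 2 μ := by
    refine (memLp_two_iff_integrable_sq (hYm.pow_const 2).aestronglyMeasurable).2 ?_
    simpa only [← pow_mul] using hY4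
  have iY : Integrable Y μ := mY.integrable one_le_two
  have bY : ∫ ω, Y ω ∂μ ≤ A := (integral_mono iY hY4 le4).trans hYA
  have bY2 : ∫ ω, Y ω ^ 2 ∂μ ≤ A := (integral_mono mY.integrable_sq hY4 le24).trans hYA
  have bY4 : ∫ ω, (Y ω ^ 2) ^ 2 ∂μ ≤ A := by simpa only [← pow_mul] using hYA
  have i1 : Integrable (fun ω => Y ω * s₁ ω) μ := mY.integrable_mul ms₁
  have i2 : Integrable (fun ω => Y ω * s₂ ω) μ := mY.integrable_mul ms₂
  have i3 : Integrable (fun ω => Y ω ^ 2 * e₁ ω) μ := mY2.integrable_mul me₁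
  have i4 : Integrable (fun ω => Y ω ^ 2 * e₂ ω) μ := mY2.integrable_mul me₂
  have i5 := iY.mul_const δ
  have i12 : Integrable (fun ω => Y ω * s₁ ω + Y ω * s₂ ω) μ := i1.add i2
  have i34 : Integrable (fun ω => 4 * (Y ω ^ 2 * e₁ ω + Y ω ^ 2 * e₂ ω)) μ :=
    (i3.add i4).const_mul 4
  have i512 : Integrable (fun ω => Y ω * δ + (Y ω * s₁ ω + Y ω * s₂ ω)) μ := i5.add i12
  refine ⟨(i512.add i34).const_mul K, ?_⟩
  rw [integral_const_mul, integral_add i512 i34, integral_add i5 i12, integral_add i1 i2,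
    integral_const_mul, integral_add i3 i4, integral_mul_const]
  gcongr
  · exact integral_mul_le_of_integral_sq_le hY0 hs₁ mY ms₁ hA bY2
  · exact integral_mul_le_of_integral_sq_le hY0 hs₂ mY ms₂ hA bY2
  · exact integral_mul_le_of_integral_sq_le hY20 he₁ mY2 me₁ hA bY4
  · exact integral_mul_le_of_integral_sq_le hY20 he₂ mY2 me₂ hA bY4

end System

end MisoNoma

/-! ### The expected rate loss. -/

open MisoNoma

theorem theorem2 (N : ℕ) (hN : 2 < N) :
    ∃ b : ℝ, 0 < b ∧ ∀ P σ Rth c α : ℝ, 0 < P → 0 < σ → 0 < Rth → 0 < c → 0 < α →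
    ∃ C : ℝ, 0 < C ∧ ∀ (B B' : ℕ) (δ : ℝ), 0 < δ → δ ≤ c * (2 : ℝ) ^ (-(α * (B : ℝ))) →
    ∀ (Ω : Type*) [MeasurableSpace Ω] (μ : Measure Ω) [IsProbabilityMeasure μ]
      (h : Fin 2 → Ω → MisoNoma.Vec N) (code : Fin (2 ^ B') → Ω → MisoNoma.Vec N)
      (j : Fin 2 → Ω → Fin (2 ^ B')) (βstar βq : Ω → ℝ),
      MisoNoma.IsSystem μ N B B' P σ ((2 : ℝ) ^ Rth - 1) δ h code j βstar βq →
      let ΔR : Ω → ℝ := fun ω =>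
        MisoNoma.rateLoss P σ (h 0 ω) (h 1 ω) (code (j 0 ω) ω) (code (j 1 ω) ω)
          (βstar ω) (βq ω)
      let F : Set Ω := MisoNoma.feasibleRegion B P σ ((2 : ℝ) ^ Rth - 1) δ h code j
      let U : Set Ω := MisoNoma.unsaturatedRegion B δ h code j
      IntegrableOn ΔR F μ ∧
      ∫ ω in F ∩ U, |ΔR ω| ∂μ ≤
        C * ((2 : ℝ) ^ (-(α * (B : ℝ))) + (2 : ℝ) ^ (-(b * (B' : ℝ)))) ∧
      ∫ ω in F, |ΔR ω| ∂μ ≤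
        C * ((2 : ℝ) ^ (-(α * (B : ℝ))) + (2 : ℝ) ^ (-(b * (B' : ℝ))) +
          ∑ k, √(∫ ω, MisoNoma.saturation B δ
            (MisoNoma.gain (h k ω) (code (j k ω) ω)) ^ 2 ∂μ)) := by
  have hN0 : 0 < N := by omega
  obtain ⟨V, hV, hrvq⟩ := exists_integral_dirError_sq_le hN0
  obtain ⟨A, hA, hmom⟩ := exists_integral_one_add_norm_sq_pow_four_le N
  refine ⟨1 / (4 * N), by positivity, fun P σ Rth c α hP hσ hR hc hα => ?_⟩
  have hε : 0 < (2 : ℝ) ^ Rth - 1 := sub_pos.2 (Real.one_lt_rpow one_lt_two hR)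
  set ε := (2 : ℝ) ^ Rth - 1
  set K := 4 * P / (σ ^ 2 * Real.log 2) * (3 + (2 + ε) * P / (ε * σ ^ 2)) with hK
  have hl : 0 < Real.log 2 := Real.log_pos one_lt_two
  have hK0 : 0 < K := by positivity
  -- The summand `c` comes from `δ ≤ c * η`, `8 * √V` from two direction errors of weight `4`, and
  -- `1` covers the saturation terms.
  refine ⟨K * A * (c + 1 + 8 * √V), by positivity, ?_⟩
  intro B B' δ hδ hδc Ω _ μ _ h code j βstar βq hsys ΔR F U
  set η : ℝ := (2 : ℝ) ^ (-(α * (B : ℝ)))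
  set r : ℝ := (2 : ℝ) ^ (-(1 / (4 * N) * (B' : ℝ)))
  have hη0 : 0 < η := by positivity
  have hr0 : 0 < r := by positivity
  have hh := fun k => (hsys.law_channel k).aemeasurable
  have hc' := fun i => (hsys.law_code i).aemeasurable
  have hicode : iIndepFun code μ := 
    hsys.indep.precomp (g := Sum.inr) Sum.inr_injective
  have he : ∀ k, √(∫ ω, dirError (h k ω) (code (j k ω) ω) ^ 2 ∂μ) ≤ √V * r := by
    intro k
    rw [← Real.sqrt_sq hr0.le, ← Real.sqrt_mul hV.le]
    exact Real.sqrt_le_sqrt (hrvq B' Ω μ (h k) code (j k) (hh k) hsys.law_code hicode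
      (indepFun_channel_code hh hc' hsys.indep k) (hsys.index_max k))
  obtain ⟨iY, bY⟩ := hmom Ω μ (h 0) (h 1) (hsys.law_channel 0) (hsys.law_channel 1)
  set Y : Ω → ℝ := fun ω => 1 + (‖h 0 ω‖ ^ 2 + ‖h 1 ω‖ ^ 2) with hYdef
  have hYm : AEMeasurable Y μ := by
    have := hh 0
    have := hh 1
    fun_prop
  have hY1 : ∀ ω, 1 ≤ Y ω := fun ω => by
    simp only [hYdef]
    linarith [sq_nonneg ‖h 0 ω‖, sq_nonneg ‖h 1 ω‖]
  set e : Fin 2 → Ω → ℝ := fun k ω => dirError (h k ω) (code (j k ω) ω) with hedef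
  set s : Fin 2 → Ω → ℝ := fun k ω => saturation B δ (gain (h k ω) (code (j k ω) ω)) with hsdef
  have he0 : ∀ k, 0 ≤ e k := fun k ω => Real.sqrt_nonneg _
  have hs0 : ∀ k, 0 ≤ s k := fun k ω => saturation_nonneg
  have me : ∀ k, MemLp (e k) 2 μ := fun k => memLp_dirError (hh k) (hsys.aemeasurable_beam k)
  have ms : ∀ k, MemLp (s k) 2 μ := fun k => hsys.memLp_saturation hδ k
  have hbound : ∀ᵐ ω ∂μ, ω ∈ F → |ΔR ω| ≤ K * (Y ω * δ + (Y ω * s 0 ω + Y ω * s 1 ω) +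
      4 * (Y ω ^ 2 * e 0 ω + Y ω ^ 2 * e 1 ω)) := by
    filter_upwards [hsys.ae_norm_beam_le_one 0, hsys.ae_norm_beam_le_one 1] with ω h0 h1 hF
    refine (abs_rateLoss_le hP hσ hε hδ h0 h1 (hsys.star_opt ω hF.1) (hsys.q_opt ω hF.2)).trans ?_
    refine mul_le_mul_of_nonneg_left ?_ hK0.le
    change Y ω * (δ + (s 0 ω + s 1 ω) + 4 * (‖h 0 ω‖ ^ 2 + ‖h 1 ω‖ ^ 2) * (e 0 ω + e 1 ω)) ≤ _
    -- The factor `Y * (Y - 1)` of the direction errors is then enlarged to `Y ^ 2`.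
    have hS : ‖h 0 ω‖ ^ 2 + ‖h 1 ω‖ ^ 2 = Y ω - 1 := by simp only [hYdef]; ring
    rw [hS]
    have hE : 0 ≤ e 0 ω + e 1 ω := add_nonneg (he0 0 ω) (he0 1 ω)
    nlinarith [mul_nonneg (zero_le_one.trans (hY1 ω)) hE]
  -- The zeros are kept so that the bound has the shape of the integral lemma with `s₁ = s₂ = 0`.
  have hboundU : ∀ᵐ ω ∂μ, ω ∈ F ∩ U → |ΔR ω| ≤ K * (Y ω * δ + (Y ω * 0 + Y ω * 0) +
      4 * (Y ω ^ 2 * e 0 ω + Y ω ^ 2 * e 1 ω)) := by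
    filter_upwards [hbound] with ω hω hFU
    have z : ∀ k, s k ω = 0 := fun k => saturation_eq_zero (hFU.2 k).2
    simpa only [z] using hω hFU.1
  have hΔ : AEMeasurable ΔR μ := hsys.aemeasurable_rateLoss
  have hYω : ∀ ω, 0 ≤ Y ω := fun ω => zero_le_one.trans (hY1 ω)
  obtain ⟨ig, bg⟩ := integrable_and_integral_bound_le hA hK0.le hδ.le hYm hY1 iY bY
    (he0 0) (he0 1) (hs0 0) (hs0 1) (me 0) (me 1) (ms 0) (ms 1)
  obtain ⟨igU, bgU⟩ := integrable_and_integral_bound_le hA hK0.le hδ.le hYm hY1 iY bY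
    (he0 0) (he0 1) (s₁ := 0) (s₂ := 0) le_rfl le_rfl (me 0) (me 1) MemLp.zero MemLp.zero
  obtain ⟨iF, bF⟩ := integrableOn_and_setIntegral_abs_le hΔ ig (fun ω => by
    have := hYω ω
    have := he0 0 ω
    have := he0 1 ω
    have := hs0 0 ω
    have := hs0 1 ω
    simp only [Pi.zero_apply] at *
    positivity) hbound
  obtain ⟨-, bFU⟩ := integrableOn_and_setIntegral_abs_le hΔ igU (fun ω => by
    have := hYω ω
    have := he0 0 ω
    have := he0 1 ω
    simp only [Pi.zero_apply] at *
    positivity) hboundU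
  have hA0 : 0 < A := by linarith
  have core : A * δ + 4 * (A * √(∫ ω, e 0 ω ^ 2 ∂μ) + A * √(∫ ω, e 1 ω ^ 2 ∂μ)) ≤
      A * (c + 1 + 8 * √V) * (η + r) := by
    have q0 := mul_le_mul_of_nonneg_left (he 0) hA0.le
    have q1 := mul_le_mul_of_nonneg_left (he 1) hA0.le
    have q2 := mul_le_mul_of_nonneg_left hδc hA0.le
    have := mul_nonneg hA0.le hη0.le
    have := mul_nonneg hA0.le hr0.le
    have := mul_nonneg (mul_nonneg hA0.le hη0.le) (Real.sqrt_nonneg V)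
    have := mul_nonneg (mul_nonneg hA0.le hr0.le) hc.le
    nlinarith
  refine ⟨iF, (bFU.trans bgU).trans ?_, (bF.trans bg).trans ?_⟩
  · simp only [Pi.zero_apply, ne_eq, OfNat.ofNat_ne_zero, not_false_eq_true, zero_pow,
      integral_zero, Real.sqrt_zero, mul_zero, add_zero]
    calc _ ≤ K * (A * (c + 1 + 8 * √V) * (η + r)) := by gcongr
      _ = _ := by ring
  · rw [Fin.sum_univ_two]
    change _ ≤ K * A * (c + 1 + 8 * √V) *
      (η + r + (√(∫ ω, s 0 ω ^ 2 ∂μ) + √(∫ ω, s 1 ω ^ 2 ∂μ)))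
    have t0 := Real.sqrt_nonneg (∫ ω, s 0 ω ^ 2 ∂μ)
    have t1 := Real.sqrt_nonneg (∫ ω, s 1 ω ^ 2 ∂μ)
    generalize √(∫ ω, s 0 ω ^ 2 ∂μ) = x at *
    generalize √(∫ ω, s 1 ω ^ 2 ∂μ) = y at *
    have hsat : A * x + A * y ≤ A * (c + 1 + 8 * √V) * (x + y) := by
      have h1 : (1 : ℝ) ≤ c + 1 + 8 * √V := by linarith [Real.sqrt_nonneg V]
      calc A * x + A * y = A * 1 * (x + y) := by ring
        _ ≤ _ := by gcongr
    calc _ ≤ K * (A * (c + 1 + 8 * √V) * (η + r) + A * (c + 1 + 8 * √V) * (x + y)) := by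
          refine mul_le_mul_of_nonneg_left ?_ hK0.le
          linarith
      _ = _ := by ring
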